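/- **Setting.** Let $\alpha>2$, $d>0$, $m_{\mathrm I}>0$, $T>0$ be real and $m_{\mathrm D}\ge 1$ an integer. For $\lambda>0$ let $\{\mathsf x_i\}_{i\in\mathbb N}$ be the points of a stationary Poisson point process of density $\lambda$ in $\mathbb R^2$; let $\mathsf g_n$ ($n=1,2$) be Gamma distributed with shape $m_{\mathrm D}$ and scale $1/m_{\mathrm D}$, and $\mathsf h_{n,i}$ ($n=1,2$, $i\in\mathbb N$) Gamma distributed with shape $m_{\mathrm I}$ and scale $1/m_{\mathrm I}$; all the gains and the point process are independent. For $\mathtt{SNR}>0$ put $$\mathsf I_n=d^{\alpha}\sum_i \mathsf h_{n,i}\|\mathsf x_i\|^{-\alpha},\qquad \mathtt P_{\mathrm{MRC}}(\lambda,\mathtt{SNR})=\mathbb P\Big(\frac{\mathsf g_1}{\mathsf I_1+\mathtt{SNR}^{-1}}+\frac{\mathsf g_2}{\mathsf I_2+\mathtt{SNR}^{-1}}\ge T\Big).$$ For $\lambda,\nu\ge 0$ let $$F(\lambda,\nu)=\sum_{k=0}^{m_{\mathrm D}-1}\frac{(-1)^{k+m_{\mathrm D}}}{k!\,\Gamma(m_{\mathrm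 D})}\int_0^\infty\frac1z\,\frac{\partial^{k}\partial^{m_{\mathrm D}}}{\partial s^{k}\partial t^{m_{\mathrm D}}}\Big[\exp\big(-(T-z)^+ s\,m_{\mathrm D}\nu-z\,t\,m_{\mathrm D}\nu-\pi\lambda\mathcal A(z,s,t)\big)\Big]_{s=t=1}\mathrm dz,$$ where, with ${}_2\mathbf F_1={}_2F_1/\Gamma(c)$ the regularized Gaussian hypergeometric function (analytically continued to real arguments below $1$), $$\mathcal A(z,s,t)=s^{2/\alpha}(T-z)^{2/\alpha}d^2\,\Gamma(1-\tfrac2\alpha)\big(\tfrac{m_{\mathrm D}}{m_{\mathrm I}}\big)^{2/\alpha}\Gamma(\tfrac2\alpha+2m_{\mathrm I})\;{}_2\mathbf F_1\Big(-\tfrac2\alpha,m_{\mathrm I};2m_{\mathrm I};1-\tfrac{zt}{(T-z)s}\Big)\quad(0\le z<T),$$ $$\mathcal A(z,s,t)=(zt)^{2/\alpha}d^2\,\Gamma(1-\tfrac2\alpha)\big(\tfrac{m_{\mathrm D}}{m_{\mathrm I}}\big)^{2/\alpha}\frac{\Gamma(\frac2\alpha+m_{\mathrm I})}{\Gamma(m_{\mathrm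 I})}\quad(z\ge T).$$ (So $F(\lambda,1/\mathtt{SNR})$ is the integral formula for the success probability, and $\nu=0$ corresponds to $\mathtt{SNR}=\infty$.) Let $Q(a,x)=\Gamma(a,x)/\Gamma(a)$ be the regularized upper incomplete Gamma function. **Corollary (Interference vs. noise).** 1. (Interference-limited regime.) For every $\lambda>0$, the derivatives in $F(\lambda,\nu)$ exist and its integrals converge absolutely for every $\nu\geq 0$, and $$\lim_{\mathtt{SNR}\to\infty}\mathtt P_{\mathrm{MRC}}(\lambda,\mathtt{SNR})=\lim_{\mathtt{SNR}\to\infty}F(\lambda,1/\mathtt{SNR})=F(\lambda,0).$$ 2. (Noise-limited regime.) For every $\mathtt{SNR}>0$, the derivatives in $F(0,1/\mathtt{SNR})$ exist and its integrals converge absolutely, and $$\lim_{\lambda\to0^+}\mathtt P_{\mathrm{MRC}}(\lambda,\mathtt{SNR})=\lim_{\lambda\to0^+}F(\lambda,1/\mathtt{SNR})=F(0,1/\mathtt{SNR})=Q\big(2m_{\mathrm D},\,m_{\mathrm D}T/\mathtt{SNR}\big).$$ -/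

import Mathlib

open MeasureTheory ProbabilityTheory Set Filter Topology
open scoped ENNReal Nat

namespace MRC

/-! ### Special functions -/

/-- Upper incomplete Gamma function `Γ(a, x) = ∫_x^∞ t^(a-1) e^(-t) dt`. -/
noncomputable def upperGamma (a x : ℝ) : ℝ :=
  ∫ t in Ioi x, t ^ (a - 1) * Real.exp (-t)

/-- Regularized upper incomplete Gamma function `Q(a, x) = Γ(a, x) / Γ(a)`. -/
noncomputable def regUpperGamma (a x : ℝ) : ℝ :=
  upperGamma a x / Real.Gamma a

/-- Regularized Gaussian hypergeometric function `₂F₁(a, b; c; x) / Γ(c)` for `0 < b < c` and real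
`x < 1`, given by Euler's integral. Mathlib's `₂F₁` is the sum of the Gauss series, which is only
meaningful for `|x| < 1`; the two agree there (`regHypergeometric_eq_series`), and the values on the
rest of the half-line `x < 1` are tied to the Gauss series by Pfaff's transformation
(`regHypergeometric_pfaff`). -/
noncomputable def regHypergeometric (a b c x : ℝ) : ℝ :=
  (∫ u in (0 : ℝ)..1, u ^ (b - 1) * (1 - u) ^ (c - b - 1) * (1 - x * u) ^ (-a)) /
    (Real.Gamma b * Real.Gamma (c - b))

theorem regHypergeometric_pfaff {a b c x : ℝ} (hx : x < 1) :
    regHypergeometric a b c x =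
      (1 - x) ^ (-a) * regHypergeometric a (c - b) c (x / (x - 1)) := by
  have hx0 : x - 1 ≠ 0 := by linarith
  have h1 : (0 : ℝ) ≤ 1 - x := by linarith
  unfold regHypergeometric
  rw [← mul_div_assoc, ← intervalIntegral.integral_const_mul, sub_sub_cancel,
    mul_comm (Real.Gamma b)]
  congr 1
  have := intervalIntegral.integral_comp_sub_left (a := 0) (b := 1)
    (fun u : ℝ => u ^ (b - 1) * (1 - u) ^ (c - b - 1) * (1 - x * u) ^ (-a)) 1
  rw [sub_self, sub_zero] at this
  rw [← this]
  refine intervalIntegral.integral_congr fun u hu => ?_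
  rw [uIcc_of_le zero_le_one] at hu
  have h2 : 0 ≤ 1 - x / (x - 1) * u := by
    have : 1 - x / (x - 1) * u = (1 - x * (1 - u)) / (1 - x) := by
      have : 1 - x ≠ 0 := by linarith
      field_simp
      ring
    rw [this]
    exact div_nonneg (by nlinarith [hu.1, hu.2]) h1
  have h3 : 1 - x * (1 - u) = (1 - x) * (1 - x / (x - 1) * u) := by
    field_simp
    ring
  simp only [sub_sub_cancel]
  rw [h3, Real.mul_rpow h1 h2]
  ring

theorem integral_beta {p q : ℝ} (hp : 0 < p) (hq : 0 < q) :
    IntervalIntegrable (fun u : ℝ => u ^ (p - 1) * (1 - u) ^ (q - 1)) volume 0 1 ∧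
    ∫ u in (0 : ℝ)..1, u ^ (p - 1) * (1 - u) ^ (q - 1) =
      Real.Gamma p * Real.Gamma q / Real.Gamma (p + q) := by
  have hcongr : ∀ u ∈ Ioc (0 : ℝ) 1, ((u ^ (p - 1) * (1 - u) ^ (q - 1) : ℝ) : ℂ) =
      (u : ℂ) ^ ((p : ℂ) - 1) * (1 - (u : ℂ)) ^ ((q : ℂ) - 1) := by
    intro u hu
    rw [Complex.ofReal_mul, Complex.ofReal_cpow hu.1.le, Complex.ofReal_cpow (by linarith [hu.2])]
    simp
  have hint := Complex.betaIntegral_convergent (u := p) (v := q) (by simpa) (by simpa)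
  have hint' : IntervalIntegrable (fun u : ℝ => ((u ^ (p - 1) * (1 - u) ^ (q - 1) : ℝ) : ℂ))
      volume 0 1 := by
    refine hint.congr ?_
    rw [uIoc_of_le zero_le_one]
    exact fun u hu => (hcongr u hu).symm
  constructor
  · rw [intervalIntegrable_iff] at hint' ⊢
    simpa [IntegrableOn] using hint'.re
  · have h := Complex.betaIntegral_eq_Gamma_mul_div p q (by simpa) (by simpa)
    have h' : ((∫ u in (0 : ℝ)..1, u ^ (p - 1) * (1 - u) ^ (q - 1) : ℝ) : ℂ) =
        Complex.betaIntegral p q := by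
      rw [← intervalIntegral.integral_ofReal, Complex.betaIntegral]
      refine intervalIntegral.integral_congr_ae (ae_of_all _ fun u hu => ?_)
      rw [uIoc_of_le zero_le_one] at hu
      exact hcongr u hu
    rw [h, ← Complex.ofReal_add, Complex.Gamma_ofReal, Complex.Gamma_ofReal,
      Complex.Gamma_ofReal] at h'
    exact_mod_cast h'

theorem gamma_add_nat {b : ℝ} (hb : 0 < b) (n : ℕ) :
    Real.Gamma (b + n) = (ascPochhammer ℝ n).eval b * Real.Gamma b := by
  induction n with
  | zero => simp
  | succ n ih =>
    rw [Nat.cast_succ, ← add_assoc, Real.Gamma_add_one (by positivity), ih,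
      ascPochhammer_succ_eval]
    ring

theorem hasSum_one_sub_rpow {a y : ℝ} (hy : |y| < 1) :
    HasSum (fun n : ℕ => (n !⁻¹ : ℝ) * (ascPochhammer ℝ n).eval a * y ^ n) ((1 - y) ^ (-a)) ∧
    Summable (fun n : ℕ => ‖(n !⁻¹ : ℝ) * (ascPochhammer ℝ n).eval a * y ^ n‖) := by
  have hmem : -y ∈ Metric.eball (0 : ℝ) 1 := by
    simpa [enorm_eq_nnnorm, ← NNReal.coe_lt_coe] using hy
  have hterm : ∀ n : ℕ, (binomialSeries ℝ (-a) n fun _ => -y) =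
      (n !⁻¹ : ℝ) * (ascPochhammer ℝ n).eval a * y ^ n := by
    intro n
    rw [binomialSeries_eq_ordinaryHypergeometricSeries (b := (1 : ℝ))
      (fun k => by have : (0 : ℝ) ≤ k := k.cast_nonneg
                   linarith), neg_neg]
    have h1 : (ascPochhammer ℝ n).eval 1 ≠ 0 := (ascPochhammer_pos n 1 one_pos).ne'
    have := ordinaryHypergeometricSeries_apply_eq a (1 : ℝ) 1 y n
    rw [mul_inv_cancel_right₀ h1] at this
    rw [FormalMultilinearSeries.compContinuousLinearMap_apply, ← smul_eq_mul, ← this]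
    congr 1
    funext i
    simp
  have hs := (Real.one_add_rpow_hasFPowerSeriesOnBall_zero (a := -a)).hasSum hmem
  have hn := (binomialSeries ℝ (-a)).summable_norm_apply
    (Metric.eball_subset_eball binomialSeries_radius_ge_one hmem)
  simp only [hterm] at hs hn
  refine ⟨?_, hn⟩
  simpa [sub_eq_add_neg] using hs

theorem regHypergeometric_eq_series {a b c x : ℝ} (hb : 0 < b) (hbc : b < c) (hx : |x| < 1) :
    regHypergeometric a b c x = ordinaryHypergeometric a b c x / Real.Gamma c := by
  have hc : 0 < c := hb.trans hbc
  have hcb : 0 < c - b := sub_pos.2 hbc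
  set C : ℕ → ℝ := fun n => (n !⁻¹ : ℝ) * (ascPochhammer ℝ n).eval a with hC
  have hmom : ∀ n : ℕ, IntervalIntegrable
      (fun u : ℝ => u ^ (b + n - 1) * (1 - u) ^ (c - b - 1)) volume 0 1 ∧
      ∫ u in (0 : ℝ)..1, u ^ (b + n - 1) * (1 - u) ^ (c - b - 1) =
        Real.Gamma (b + n) * Real.Gamma (c - b) / Real.Gamma (c + n) := by
    intro n
    have := integral_beta (p := b + n) (q := c - b) (by positivity) hcb
    rwa [show b + n + (c - b) = c + n by ring] at this
  have hF : ∀ n : ℕ, ∀ u ∈ Ioc (0 : ℝ) 1,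
      u ^ (b - 1) * (1 - u) ^ (c - b - 1) * (C n * (x * u) ^ n) =
        C n * x ^ n * (u ^ (b + n - 1) * (1 - u) ^ (c - b - 1)) := by
    intro n u hu
    rw [show b + n - 1 = b - 1 + n by ring, Real.rpow_add hu.1, Real.rpow_natCast, mul_pow]
    ring
  have hbase := (hmom 0).1
  simp only [Nat.cast_zero, add_zero] at hbase
  have key : HasSum (fun n : ℕ => ∫ u in Ioc (0 : ℝ) 1,
      u ^ (b - 1) * (1 - u) ^ (c - b - 1) * (C n * (x * u) ^ n))
      (∫ u in Ioc (0 : ℝ) 1, u ^ (b - 1) * (1 - u) ^ (c - b - 1) * (1 - x * u) ^ (-a)) := by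
    have hint : ∀ n : ℕ, IntegrableOn (fun u : ℝ =>
        u ^ (b - 1) * (1 - u) ^ (c - b - 1) * (C n * (x * u) ^ n)) (Ioc 0 1) := by
      intro n
      refine IntegrableOn.congr_fun (f := fun u : ℝ =>
        C n * x ^ n * (u ^ (b + n - 1) * (1 - u) ^ (c - b - 1))) ?_
        (fun u hu => (hF n u hu).symm) measurableSet_Ioc
      exact (((intervalIntegrable_iff_integrableOn_Ioc_of_le zero_le_one).1 (hmom n).1)).const_mul _
    have hsum : Summable fun n : ℕ => ∫ u in Ioc (0 : ℝ) 1,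
        ‖u ^ (b - 1) * (1 - u) ^ (c - b - 1) * (C n * (x * u) ^ n)‖ := by
      refine Summable.of_nonneg_of_le (fun n => integral_nonneg fun u => norm_nonneg _) ?_
        ((hasSum_one_sub_rpow (a := a) hx).2.mul_right
          (∫ u in Ioc (0 : ℝ) 1, u ^ (b - 1) * (1 - u) ^ (c - b - 1)))
      intro n
      rw [← integral_const_mul]
      refine setIntegral_mono_on (hint n).norm
        (((intervalIntegrable_iff_integrableOn_Ioc_of_le zero_le_one).1 hbase).const_mul _)
        measurableSet_Ioc fun u hu => ?_
      have hw : 0 ≤ u ^ (b - 1) * (1 - u) ^ (c - b - 1) :=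
        mul_nonneg (Real.rpow_nonneg hu.1.le _) (Real.rpow_nonneg (by linarith [hu.2]) _)
      rw [norm_mul, Real.norm_of_nonneg hw, mul_comm]
      refine mul_le_mul_of_nonneg_right ?_ hw
      rw [norm_mul, norm_mul (C n)]
      refine mul_le_mul_of_nonneg_left ?_ (norm_nonneg _)
      rw [mul_pow, norm_mul]
      refine mul_le_of_le_one_right (norm_nonneg _) ?_
      rw [norm_pow, Real.norm_of_nonneg hu.1.le]
      exact pow_le_one₀ hu.1.le hu.2
    have hS := hasSum_integral_of_summable_integral_norm hint hsum
    suffices heq : (∫ u in Ioc (0 : ℝ) 1,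
        u ^ (b - 1) * (1 - u) ^ (c - b - 1) * (1 - x * u) ^ (-a)) =
        ∫ u in Ioc (0 : ℝ) 1, ∑' n : ℕ,
          u ^ (b - 1) * (1 - u) ^ (c - b - 1) * (C n * (x * u) ^ n) by
      rw [heq]
      exact hS
    refine setIntegral_congr_fun measurableSet_Ioc fun u hu => ?_
    have hxu : |x * u| < 1 := by
      rw [abs_mul, abs_of_pos hu.1]
      nlinarith [hu.1, hu.2, abs_nonneg x]
    exact (((hasSum_one_sub_rpow (a := a) hxu).1.mul_left _).tsum_eq).symm
  unfold regHypergeometric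
  rw [intervalIntegral.integral_of_le zero_le_one, ← key.tsum_eq, ordinaryHypergeometric_eq_tsum,
    ← tsum_div_const, ← tsum_div_const]
  refine tsum_congr fun n => ?_
  rw [setIntegral_congr_fun measurableSet_Ioc (hF n), integral_const_mul,
    ← intervalIntegral.integral_of_le zero_le_one, (hmom n).2, gamma_add_nat hb, gamma_add_nat hc]
  have h1 := (Real.Gamma_pos_of_pos hb).ne'
  have h2 := (Real.Gamma_pos_of_pos hc).ne'
  have h3 := (Real.Gamma_pos_of_pos hcb).ne'
  have h4 := (ascPochhammer_pos n c hc).ne'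
  simp only [hC, smul_eq_mul]
  field_simp

/-! ### Network model -/

/-- Number of points of the (enumerated) point configuration `x` that lie in `B`. -/
noncomputable def pointCount {Ω E : Type*} (x : ℕ → Ω → E) (B : Set E) (ω : Ω) : ℕ∞ :=
  {i | x i ω ∈ B}.encard

/-- `x` enumerates the points of a Poisson point process with intensity measure `Λ`. -/
structure IsPoissonPointProcess {Ω E : Type*} [MeasurableSpace Ω] [MeasurableSpace E]
    (P : Measure Ω) (Λ : Measure E) (x : ℕ → Ω → E) : Prop where
  measurable : ∀ i, Measurable (x i)
  count_law : ∀ B, MeasurableSet B → Λ B ≠ ∞ →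
    ∀ k : ℕ, P {ω | pointCount x B ω = k} = poissonMeasure (Λ B).toNNReal {k}
  count_indep : ∀ (n : ℕ) (B : Fin n → Set E), (∀ j, MeasurableSet (B j)) →
    Pairwise (fun i j => Disjoint (B i) (B j)) → iIndepFun (fun j => pointCount x (B j)) P

/-- All power fading gains: those of the desired links (`g n` for antenna `n`) and those of the
interfering links (`h n i` for antenna `n` and interferer `i`). -/
def fading {Ω : Type*} {N : ℕ} (g : Fin N → Ω → ℝ) (h : Fin N → ℕ → Ω → ℝ) :
    Fin N ⊕ Fin N × ℕ → Ω → ℝ :=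
  Sum.elim g (fun p => h p.1 p.2)

/-- The `N`-antenna network: the interferers `x` form a stationary planar Poisson point process of
density `lam`; the gains are Gamma distributed with shape and rate `mD` (desired links), resp. `mI`
(interfering links); all gains and the point process are independent. -/
structure IsNetwork {Ω : Type*} [MeasurableSpace Ω] {N : ℕ} (P : Measure Ω) (lam : ℝ)
    (mD : ℕ) (mI : ℝ) (x : ℕ → Ω → EuclideanSpace ℝ (Fin 2)) (g : Fin N → Ω → ℝ)
    (h : Fin N → ℕ → Ω → ℝ) : Prop where
  isProbabilityMeasure : IsProbabilityMeasure P
  points : IsPoissonPointProcess P (ENNReal.ofReal lam • volume) x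
  measurable_g : ∀ n, Measurable (g n)
  measurable_h : ∀ n i, Measurable (h n i)
  law_g : ∀ n, P.map (g n) = gammaMeasure mD mD
  law_h : ∀ n i, P.map (h n i) = gammaMeasure mI mI
  indep_fading : iIndepFun (fading g h) P
  indep_points : IndepFun (fun ω i => x i ω) (fun ω j => fading g h j ω) P

/-- Interference power `d^α ∑ᵢ hᵢ ‖xᵢ‖^(-α)` at an antenna with interfering gains `h`. -/
noncomputable def interference {Ω : Type*} (α d : ℝ) (x : ℕ → Ω → EuclideanSpace ℝ (Fin 2))
    (h : ℕ → Ω → ℝ) (ω : Ω) : ℝ≥0∞ :=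
  ENNReal.ofReal (d ^ α) * ∑' i, ENNReal.ofReal (h i ω) * ‖x i ω‖ₑ ^ (-α)

/-- Post-combiner signal-to-interference-plus-noise ratio of maximal-ratio combining. -/
noncomputable def sinr {Ω : Type*} {N : ℕ} (α d SNR : ℝ) (x : ℕ → Ω → EuclideanSpace ℝ (Fin 2))
    (g : Fin N → Ω → ℝ) (h : Fin N → ℕ → Ω → ℝ) (ω : Ω) : ℝ≥0∞ :=
  ∑ n, ENNReal.ofReal (g n ω) / (interference α d x (h n) ω + ENNReal.ofReal SNR⁻¹)

/-- Success probability `ℙ(SINR ≥ T)`. -/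
noncomputable def successProb {Ω : Type*} [MeasurableSpace Ω] {N : ℕ} (P : Measure Ω)
    (α d SNR T : ℝ) (x : ℕ → Ω → EuclideanSpace ℝ (Fin 2))
    (g : Fin N → Ω → ℝ) (h : Fin N → ℕ → Ω → ℝ) : ℝ :=
  P.real {ω | ENNReal.ofReal T ≤ sinr α d SNR x g h ω}

/-! ### The integral formula for dual-branch combining -/

/-- The function `𝒜(z, s, t)`. -/
noncomputable def calA (α d : ℝ) (mD : ℕ) (mI T z s t : ℝ) : ℝ :=
  if z < T then
    s ^ (2 / α) * (T - z) ^ (2 / α) * d ^ 2 * Real.Gamma (1 - 2 / α) * (mD / mI) ^ (2 / α) *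
      Real.Gamma (2 / α + 2 * mI) *
      regHypergeometric (-(2 / α)) mI (2 * mI) (1 - z * t / ((T - z) * s))
  else
    (z * t) ^ (2 / α) * d ^ 2 * Real.Gamma (1 - 2 / α) * (mD / mI) ^ (2 / α) *
      (Real.Gamma (2 / α + mI) / Real.Gamma mI)

/-- The exponential in the formula. Here `ν` stands for `1 / SNR`, so `ν = 0` is `SNR = ∞`. -/
noncomputable def bracket (α d lam : ℝ) (mD : ℕ) (mI T ν z s t : ℝ) : ℝ :=
  Real.exp (-(max 0 (T - z) * s * mD * ν) - z * t * mD * ν -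
    Real.pi * lam * calA α d mD mI T z s t)

/-- The integrand of the `k`-th summand, `z⁻¹ ∂ₛᵏ ∂ₜ^mD [⋯]` at `s = t = 1`. -/
noncomputable def integrand (α d lam : ℝ) (mD : ℕ) (mI T ν : ℝ) (k : ℕ) (z : ℝ) : ℝ :=
  z⁻¹ * iteratedDeriv k
    (fun s => iteratedDeriv mD (fun t => bracket α d lam mD mI T ν z s t) 1) 1

/-- The integral formula for the success probability, as a function of the density `lam` and of
`ν = 1 / SNR`. -/
noncomputable def formula (α d lam : ℝ) (mD : ℕ) (mI T ν : ℝ) : ℝ :=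
  ∑ k ∈ Finset.range mD, (-1) ^ (k + mD) / (k ! * Real.Gamma mD) *
    ∫ z in Ioi (0 : ℝ), integrand α d lam mD mI T ν k z

/-- The derivatives and the integrals in the formula exist. -/
def FormulaMeaningful (α d lam : ℝ) (mD : ℕ) (mI T ν : ℝ) : Prop :=
  (∀ z : ℝ, 0 < z →
    (∀ᶠ s in 𝓝 (1 : ℝ), ContDiffAt ℝ mD (fun t => bracket α d lam mD mI T ν z s t) 1) ∧
    ContDiffAt ℝ mD
      (fun s => iteratedDeriv mD (fun t => bracket α d lam mD mI T ν z s t) 1) 1) ∧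
  ∀ k < mD, IntegrableOn (integrand α d lam mD mI T ν k) (Ioi 0)

end MRC

/-! Write `W₁`, `W₂` for interference plus noise `ν` at the two antennas. Conditioning on them, the
success probability is `condSuccess`. The variable `z = g₂ / W₂` has density `z⁻¹ (m z W₂)^m e^(-m z
W₂) / Γ(m)` with `m = mD`, and since `m` is an integer, the tail of `g₁` at `W₁ (T - z)⁺` is the
finite Poisson sum with mean `m W₁ (T - z)⁺`.

Every term of that product is, up to the sign `(-1)^(k + m)`, a `k`-th `s`-derivative and `m`-th
`t`-derivative at `s = t = 1` of `exp(-s m (T - z)⁺ W₁ - t m z W₂)`. The bracket in the formula is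
the expectation of this exponential (`IsNetwork.bracketIsLaplace`). Differentiating under the
expectation and applying Fubini gives `F = E[condSuccess(W₁, W₂)]` as soon as `W₂ > 0` almost surely
(`BracketIsLaplace.formula_eq`). This covers `ν = 0`, because the interference is almost surely
positive, and `λ = 0`, with both powers equal to the constant `ν`. For positive noise and density
the success probability is the same expectation (`IsNetwork.successProb_eq`), so both limits concern
`E[condSuccess]` only.

The joint Laplace transform of the interference comes from the generating functional of the Poisson
process. Its exponent is a spatial integral of `1 - E exp(-(a X + b Y) (d / ‖x‖)^α)` with
independent Gamma gains `X`, `Y`. Integrating over the plane first leaves the moment `E (a X + b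
Y)^(2/α)`, and the total/share decomposition of `(X, Y)` turns this into Euler's integral for the
hypergeometric function (`calA_eq_gammaMoment`).

As `SNR → ∞`, dominated convergence applies on one probability space. As `λ → 0`, the networks live
on unrelated spaces, so convergence is quantified by `1 - E exp(-(I₁ + I₂)) → 0`. The limit
`condSuccess(ν, ν)` is a tail of `g₁ + g₂`, which has Gamma shape `2m`. -/

namespace MRC

/-! ### The function `y ↦ e^(-y)` on `[0, ∞]` -/

/-- `y ↦ e^(-y)` on `[0, ∞]`. -/
noncomputable def expNeg (y : ℝ≥0∞) : ℝ≥0∞ := EReal.exp (-(y : EReal))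

@[simp] theorem expNeg_zero : expNeg 0 = 1 := by simp [expNeg]

@[simp] theorem expNeg_top : expNeg ∞ = 0 := by simp [expNeg]

theorem expNeg_add (x y : ℝ≥0∞) : expNeg (x + y) = expNeg x * expNeg y := by
  unfold expNeg
  rw [← EReal.exp_add, EReal.coe_ennreal_add, EReal.neg_add (by simp) (by simp), sub_eq_add_neg]

theorem expNeg_ofReal {x : ℝ} (hx : 0 ≤ x) :
    expNeg (ENNReal.ofReal x) = ENNReal.ofReal (Real.exp (-x)) := by
  unfold expNeg
  rw [EReal.coe_ennreal_ofReal, max_eq_left hx, ← EReal.coe_neg, EReal.exp_coe]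

theorem continuous_expNeg : Continuous expNeg :=
  ENNReal.continuous_exp.comp (continuous_neg.comp continuous_coe_ennreal_ereal)

@[fun_prop] theorem measurable_expNeg : Measurable expNeg := continuous_expNeg.measurable

theorem antitone_expNeg : Antitone expNeg := fun x y hxy => by
  unfold expNeg
  exact EReal.exp_monotone (EReal.neg_le_neg_iff.2 (EReal.coe_ennreal_le_coe_ennreal_iff.2 hxy))

theorem expNeg_le_one (y : ℝ≥0∞) : expNeg y ≤ 1 := by
  simpa using antitone_expNeg (zero_le : 0 ≤ y)

theorem expNeg_ne_top (y : ℝ≥0∞) : expNeg y ≠ ∞ := ((expNeg_le_one y).trans_lt (by simp)).ne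

theorem expNeg_sum {ι : Type*} (s : Finset ι) (f : ι → ℝ≥0∞) :
    expNeg (∑ i ∈ s, f i) = ∏ i ∈ s, expNeg (f i) := by
  classical
  induction s using Finset.induction_on with
  | empty => simp
  | insert a s ha ih => rw [Finset.sum_insert ha, Finset.prod_insert ha, expNeg_add, ih]

theorem tendsto_prod_expNeg (f : ℕ → ℝ≥0∞) :
    Tendsto (fun n => ∏ i ∈ Finset.range n, expNeg (f i)) atTop (𝓝 (expNeg (∑' i, f i))) := by
  simp_rw [← expNeg_sum]
  exact (continuous_expNeg.tendsto _).comp (ENNReal.tendsto_nat_tsum f)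

/-- `y ↦ -log y`, as a function from `[0, ∞]` to `[0, ∞]`. -/
noncomputable def negLog (v : ℝ≥0∞) : ℝ≥0∞ := (-ENNReal.log v).toENNReal

theorem measurable_negLog : Measurable negLog :=
  ENNReal.measurable_log.neg.ereal_toENNReal

/-- Lets a product of factors in `[0, 1]`, zero included, be written as `expNeg` of a sum, so that
the generating functional becomes a case of the Laplace functional. The bound by 1 keeps `-log v`
from being truncated. -/
theorem expNeg_negLog {v : ℝ≥0∞} (hv : v ≤ 1) : expNeg (negLog v) = v := by
  unfold expNeg negLog
  rw [EReal.coe_toENNReal, neg_neg, ENNReal.exp_log]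
  have : ENNReal.log v ≤ 0 := by simpa using ENNReal.log_monotone hv
  exact EReal.neg_nonneg.2 this

/-! ### Laplace functional of a Poisson point process -/

theorem pointCount_eq_tsum {Ω E : Type*} (x : ℕ → Ω → E) (B : Set E) (ω : Ω) :
    (pointCount x B ω : ℝ≥0∞) = ∑' i, B.indicator 1 (x i ω) := by
  rw [pointCount, ← ENNReal.tsum_set_one, tsum_subtype {i | x i ω ∈ B} fun _ => (1 : ℝ≥0∞)]
  rfl

section PoissonProcess

variable {Ω E : Type*} [MeasurableSpace Ω] [MeasurableSpace E] {P : Measure Ω} {Λ : Measure E}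
  {x : ℕ → Ω → E}

theorem expNeg_mul_natCast (c : ℝ≥0∞) (n : ℕ) : expNeg (c * n) = expNeg c ^ n := by
  induction n with
  | zero => simp
  | succ n ih => rw [Nat.cast_succ, mul_add, mul_one, expNeg_add, ih, pow_succ]

/-- Probability generating function of the Poisson law. -/
theorem lintegral_expNeg_poissonMeasure (r : NNReal) (c : ℝ≥0∞) :
    ∫⁻ n : ℕ, expNeg (c * n) ∂(poissonMeasure r) = expNeg ((1 - expNeg c) * r) := by
  obtain ⟨u, hu⟩ : ∃ u : NNReal, expNeg c = u := ⟨_, (ENNReal.coe_toNNReal (expNeg_ne_top c)).symm⟩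
  have hu1 : (u : ℝ) ≤ 1 := by
    have := expNeg_le_one c
    rw [hu] at this
    exact_mod_cast this
  have hsum : HasSum (fun n : ℕ => ((u : ℝ) * r) ^ n / n !) (Real.exp (u * r)) := by
    rw [Real.exp_eq_exp_ℝ]
    exact NormedSpace.expSeries_div_hasSum_exp _
  rw [lintegral_countable']
  have hterm : ∀ n : ℕ, expNeg (c * n) * poissonMeasure r {n} =
      ENNReal.ofReal (Real.exp (-r)) * ENNReal.ofReal (((u : ℝ) * r) ^ n / n !) := by
    intro n
    rw [expNeg_mul_natCast, hu, poissonMeasure_singleton, ← ENNReal.ofReal_coe_nnreal,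
      ← ENNReal.ofReal_pow (by positivity), ← ENNReal.ofReal_mul (by positivity),
      ← ENNReal.ofReal_mul (by positivity)]
    congr 1
    ring
  simp_rw [hterm]
  rw [ENNReal.tsum_mul_left, ← ENNReal.ofReal_tsum_of_nonneg (fun n => by positivity) hsum.summable,
    hsum.tsum_eq, ← ENNReal.ofReal_mul (by positivity), ← Real.exp_add, hu,
    ← ENNReal.ofReal_coe_nnreal, ← ENNReal.ofReal_one, ← ENNReal.ofReal_sub _ (by positivity),
    ← ENNReal.ofReal_coe_nnreal, ← ENNReal.ofReal_mul (by linarith), expNeg_ofReal]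
  · congr 2
    ring
  · exact mul_nonneg (by linarith) r.2

theorem measurable_pointCount (hx : ∀ i, Measurable (x i)) {B : Set E} (hB : MeasurableSet B) :
    Measurable (pointCount x B) := by
  have h : Measurable fun ω => (pointCount x B ω : ℝ≥0∞) := by
    simp_rw [pointCount_eq_tsum]
    exact Measurable.tsum fun i => (measurable_one.indicator hB).comp (hx i)
  refine measurable_to_countable' fun k => ?_
  have : pointCount x B ⁻¹' {k} = (fun ω => (pointCount x B ω : ℝ≥0∞)) ⁻¹' {(k : ℝ≥0∞)} := by
    ext ω
    simp
  rw [this]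
  exact h (measurableSet_singleton _)

/-- `count_law` fixes the masses of finite counts only. They already add up to 1, so the value `⊤`
has mass 0 on both sides. -/
theorem IsPoissonPointProcess.map_pointCount [IsProbabilityMeasure P]
    (hx : IsPoissonPointProcess P Λ x) {B : Set E} (hB : MeasurableSet B) (hΛ : Λ B ≠ ∞) :
    P.map (pointCount x B) = (poissonMeasure (Λ B).toNNReal).map ((↑) : ℕ → ℕ∞) := by
  have hm := measurable_pointCount hx.measurable hB
  have hc : Measurable ((↑) : ℕ → ℕ∞) := measurable_of_countable _
  have := Measure.isProbabilityMeasure_map (μ := P) hm.aemeasurable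
  have := Measure.isProbabilityMeasure_map (μ := poissonMeasure (Λ B).toNNReal) hc.aemeasurable
  have hk : ∀ k : ℕ, P.map (pointCount x B) {(k : ℕ∞)} =
      (poissonMeasure (Λ B).toNNReal).map ((↑) : ℕ → ℕ∞) {(k : ℕ∞)} := by
    intro k
    rw [Measure.map_apply hm (measurableSet_singleton _),
      Measure.map_apply hc (measurableSet_singleton _)]
    have : ((↑) : ℕ → ℕ∞) ⁻¹' {(k : ℕ∞)} = {k} := by ext; simp
    rw [this, ← hx.count_law B hB hΛ k]
    rfl
  have htop : ({⊤} : Set ℕ∞) = (⋃ k : ℕ, {(k : ℕ∞)})ᶜ := by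
    ext a
    induction a <;> simp
  refine Measure.ext_of_singleton fun a => ?_
  induction a with
  | coe k => exact hk k
  | top =>
    rw [htop, prob_compl_eq_one_sub (MeasurableSet.of_discrete),
      prob_compl_eq_one_sub (MeasurableSet.of_discrete)]
    congr 1
    rw [measure_iUnion, measure_iUnion]
    · simp_rw [hk]
    all_goals first
      | exact fun _ => MeasurableSet.of_discrete
      | exact fun i j hij => by simpa using hij

theorem IsPoissonPointProcess.lintegral_expNeg_pointCount [IsProbabilityMeasure P]
    (hx : IsPoissonPointProcess P Λ x) {B : Set E} (hB : MeasurableSet B) (hΛ : Λ B ≠ ∞)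
    (c : ℝ≥0∞) :
    ∫⁻ ω, expNeg (c * pointCount x B ω) ∂P = expNeg ((1 - expNeg c) * Λ B) := by
  have h1 := lintegral_map (μ := P) (f := fun n : ℕ∞ => expNeg (c * n))
    (measurable_of_countable _) (measurable_pointCount hx.measurable hB)
  rw [← h1, hx.map_pointCount hB hΛ, lintegral_map (measurable_of_countable _)
    (measurable_of_countable _)]
  simpa [ENNReal.coe_toNNReal hΛ] using lintegral_expNeg_poissonMeasure (Λ B).toNNReal c

/-- Laplace functional for simple functions. -/
theorem IsPoissonPointProcess.lintegral_expNeg_simpleFunc [IsProbabilityMeasure P]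
    (hx : IsPoissonPointProcess P Λ x) (f : SimpleFunc E ℝ≥0∞)
    (hf : ∀ c ≠ 0, Λ (f ⁻¹' {c}) ≠ ∞) :
    ∫⁻ ω, expNeg (∑' i, f (x i ω)) ∂P = expNeg (∫⁻ y, (1 - expNeg (f y)) ∂Λ) := by
  set e := f.range.equivFin
  have hmeas : ∀ c, MeasurableSet (f ⁻¹' {c}) := fun c => f.measurableSet_fiber c
  have hind := hx.count_indep f.range.card (fun j => f ⁻¹' {(e.symm j : ℝ≥0∞)})
    (fun j => hmeas _) (by
      intro i j hij
      refine Disjoint.preimage _ ?_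
      simpa using fun h => hij (e.symm.injective (Subtype.ext h)))
  -- Sorting the points by the value of `f` leaves finitely many counts over disjoint fibres, which
  -- are independent.
  have hpt : ∀ ω, ∑' i, f (x i ω) =
      ∑ j, (e.symm j : ℝ≥0∞) * (pointCount x (f ⁻¹' {(e.symm j : ℝ≥0∞)}) ω : ℝ≥0∞) := by
    intro ω
    simp_rw [pointCount_eq_tsum, ← ENNReal.tsum_mul_left]
    rw [← Summable.tsum_finsetSum (fun _ _ => ENNReal.summable)]
    refine tsum_congr fun i => ?_
    rw [Finset.sum_eq_single (e ⟨f (x i ω), f.mem_range_self _⟩)]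
    · simp
    · intro j _ hj
      rw [Set.indicator_of_notMem, mul_zero]
      rintro (h : f (x i ω) = _)
      exact hj (by simp [h])
    · simp
  have hcomp := hind.comp (fun j n => expNeg ((e.symm j : ℝ≥0∞) * n))
    (fun j => measurable_of_countable _)
  have hprod := lintegral_prod_eq_prod_lintegral_of_indepFun Finset.univ _ hcomp
    (fun j => (measurable_of_countable _).comp (measurable_pointCount hx.measurable (hmeas _)))
  simp only [Function.comp_apply] at hprod
  simp_rw [hpt, expNeg_sum]
  rw [hprod]
  have hone : ∀ j, ∫⁻ ω, expNeg ((e.symm j : ℝ≥0∞) *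
      (pointCount x (f ⁻¹' {(e.symm j : ℝ≥0∞)}) ω : ℝ≥0∞)) ∂P =
      expNeg ((1 - expNeg (e.symm j : ℝ≥0∞)) * Λ (f ⁻¹' {(e.symm j : ℝ≥0∞)})) := by
    intro j
    -- The fibre over 0 may have infinite measure, but both sides are then 1.
    by_cases h0 : (e.symm j : ℝ≥0∞) = 0
    · simp [h0]
    · exact hx.lintegral_expNeg_pointCount (hmeas _) (hf _ h0) _
  simp_rw [hone]
  rw [← expNeg_sum]
  congr 1
  have h2 := SimpleFunc.map_lintegral (μ := Λ) (fun c => 1 - expNeg c) f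
  rw [← SimpleFunc.lintegral_eq_lintegral] at h2
  simp only [SimpleFunc.map_apply] at h2
  rw [h2, ← Finset.sum_coe_sort f.range]
  exact Fintype.sum_equiv e.symm _ _ fun j => rfl

/-- Laplace functional of a Poisson point process. -/
theorem IsPoissonPointProcess.lintegral_expNeg_tsum [IsProbabilityMeasure P] [SigmaFinite Λ]
    (hx : IsPoissonPointProcess P Λ x) {f : E → ℝ≥0∞} (hf : Measurable f) :
    ∫⁻ ω, expNeg (∑' i, f (x i ω)) ∂P = expNeg (∫⁻ y, (1 - expNeg (f y)) ∂Λ) := by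
  -- Cutting off to the spanning sets gives nonzero fibres finite measure, and the approximations
  -- still increase to `f`.
  set F : ℕ → SimpleFunc E ℝ≥0∞ := fun n => (SimpleFunc.eapprox f n).restrict (spanningSets Λ n)
  have hFapp : ∀ n y, F n y = (spanningSets Λ n).indicator (SimpleFunc.eapprox f n) y := fun n y =>
    SimpleFunc.restrict_apply _ (measurableSet_spanningSets Λ n) _
  have hmono : ∀ y, Monotone fun n => F n y := by
    intro y m n hmn
    simp only [hFapp]
    exact (Set.indicator_le_indicator_of_subset (monotone_spanningSets Λ hmn)
      (fun _ => zero_le) y).trans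
      (Set.indicator_le_indicator (SimpleFunc.monotone_eapprox f hmn y))
  have hlim : ∀ y, Tendsto (fun n => F n y) atTop (𝓝 (f y)) := by
    intro y
    have h1 : Tendsto (fun n => SimpleFunc.eapprox f n y) atTop (𝓝 (f y)) := by
      rw [← SimpleFunc.iSup_eapprox_apply hf y]
      exact tendsto_atTop_iSup fun m n hmn => SimpleFunc.monotone_eapprox f hmn y
    refine h1.congr' ?_
    filter_upwards [eventually_ge_atTop (spanningSetsIndex Λ y)] with n hn
    rw [hFapp, Set.indicator_of_mem]
    exact monotone_spanningSets Λ hn (mem_spanningSetsIndex Λ y)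
  have hfin : ∀ n, ∀ c ≠ 0, Λ (F n ⁻¹' {c}) ≠ ∞ := by
    intro n c hc
    refine ((measure_mono ?_).trans_lt (measure_spanningSets_lt_top Λ n)).ne
    rintro y (hy : F n y = c)
    by_contra h
    rw [hFapp, Set.indicator_of_notMem h] at hy
    exact hc hy.symm
  have hL : Tendsto (fun n => ∫⁻ ω, expNeg (∑' i, F n (x i ω)) ∂P) atTop
      (𝓝 (∫⁻ ω, expNeg (∑' i, f (x i ω)) ∂P)) := by
    refine tendsto_lintegral_of_dominated_convergence (fun _ => 1) (fun n => ?_)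
      (fun n => ae_of_all _ fun ω => expNeg_le_one _) (by simp) (ae_of_all _ fun ω => ?_)
    · exact measurable_expNeg.comp (Measurable.tsum fun i =>
        (F n).measurable.comp (hx.measurable i))
    · refine (continuous_expNeg.tendsto _).comp ?_
      -- The sum over the points is an integral against counting measure, so monotone convergence
      -- applies to it.
      simp_rw [← lintegral_count]
      exact lintegral_tendsto_of_tendsto_of_monotone
        (fun n => (measurable_of_countable _).aemeasurable)
        (ae_of_all _ fun i => hmono _) (ae_of_all _ fun i => hlim _)
  have hR : Tendsto (fun n => expNeg (∫⁻ y, (1 - expNeg (F n y)) ∂Λ)) atTop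
      (𝓝 (expNeg (∫⁻ y, (1 - expNeg (f y)) ∂Λ))) := by
    refine (continuous_expNeg.tendsto _).comp (lintegral_tendsto_of_tendsto_of_monotone
      (fun n => ?_) (ae_of_all _ fun y m n hmn => ?_) (ae_of_all _ fun y => ?_))
    · exact (measurable_const.sub (measurable_expNeg.comp (F n).measurable)).aemeasurable
    · exact tsub_le_tsub_left (antitone_expNeg (hmono y hmn)) _
    · exact ENNReal.Tendsto.sub tendsto_const_nhds
        ((continuous_expNeg.tendsto _).comp (hlim y)) (by simp)
  refine tendsto_nhds_unique hL (hR.congr fun n => ?_)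
  exact (hx.lintegral_expNeg_simpleFunc (F n) (hfin n)).symm

/-- Probability generating functional of a Poisson point process. -/
theorem IsPoissonPointProcess.lintegral_expNeg_tsum_negLog [IsProbabilityMeasure P] [SigmaFinite Λ]
    (hx : IsPoissonPointProcess P Λ x) {v : E → ℝ≥0∞} (hv : Measurable v) (hv1 : ∀ y, v y ≤ 1) :
    ∫⁻ ω, expNeg (∑' i, negLog (v (x i ω))) ∂P = expNeg (∫⁻ y, (1 - v y) ∂Λ) := by
  have := hx.lintegral_expNeg_tsum (measurable_negLog.comp hv)
  simpa only [Function.comp_apply, expNeg_negLog (hv1 _)] using this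

end PoissonProcess

/-! ### The spatial integral -/

/-- Layer-cake form of `∫₀^y e^(-v) dv`. With the indicator, Tonelli reduces the spatial integral to
areas of superlevel sets; `y = ∞` is needed at the origin. -/
theorem one_sub_expNeg_eq_lintegral (y : ℝ≥0∞) :
    1 - expNeg y = ∫⁻ v in Ioi (0 : ℝ),
      {v : ℝ | ENNReal.ofReal v < y}.indicator (fun v => ENNReal.ofReal (Real.exp (-v))) v := by
  have hint : IntegrableOn (fun v : ℝ => Real.exp (-v)) (Ioi 0) := by
    simpa using exp_neg_integrableOn_Ioi 0 one_pos
  induction y using ENNReal.recTopCoe with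
  | top =>
    simp only [expNeg_top, tsub_zero, ENNReal.ofReal_lt_top, ofPred_true, indicator_univ]
    rw [← ofReal_integral_eq_lintegral_ofReal hint (ae_of_all _ fun v => (Real.exp_pos _).le),
      integral_exp_neg_Ioi_zero, ENNReal.ofReal_one]
  | coe r =>
    have hset : {v : ℝ | ENNReal.ofReal v < r} ∩ Ioi 0 = Ioo 0 (r : ℝ) := by
      ext v
      simp only [mem_inter_iff, mem_ofPred_eq, mem_Ioi, mem_Ioo]
      constructor
      · rintro ⟨h1, h2⟩
        refine ⟨h2, ?_⟩
        rwa [← ENNReal.ofReal_coe_nnreal, ENNReal.ofReal_lt_ofReal_iff_of_nonneg h2.le] at h1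
      · rintro ⟨h1, h2⟩
        refine ⟨?_, h1⟩
        rwa [← ENNReal.ofReal_coe_nnreal, ENNReal.ofReal_lt_ofReal_iff_of_nonneg h1.le]
    have hmeas : MeasurableSet {v : ℝ | ENNReal.ofReal v < r} :=
      measurableSet_lt ENNReal.measurable_ofReal measurable_const
    rw [lintegral_indicator hmeas, Measure.restrict_restrict hmeas, hset,
      ← ofReal_integral_eq_lintegral_ofReal (hint.mono_set Ioo_subset_Ioi_self)
        (ae_of_all _ fun v => (Real.exp_pos _).le), ← integral_Ioc_eq_integral_Ioo,
      ← intervalIntegral.integral_of_le (show (0 : ℝ) ≤ r from r.2),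
      ← ENNReal.ofReal_coe_nnreal, expNeg_ofReal (show (0 : ℝ) ≤ r from r.2),
      ← ENNReal.ofReal_one, ← ENNReal.ofReal_sub _ (Real.exp_pos _).le]
    congr 1
    rw [intervalIntegral.integral_comp_neg (fun v => Real.exp v), integral_exp]
    simp

/-- The path gain decreases with the distance, so its superlevel sets are discs; the centre belongs
to them because `0 ^ (-α) = ∞`. -/
theorem setOf_ofReal_lt_mul_enorm_rpow {α w v : ℝ} (hα : 0 < α) (hw : 0 < w) (hv : 0 < v) :
    {x : EuclideanSpace ℝ (Fin 2) | ENNReal.ofReal v < ENNReal.ofReal w * ‖x‖ₑ ^ (-α)} =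
      Metric.ball 0 ((w / v) ^ α⁻¹) := by
  ext x
  rw [mem_ofPred_eq, mem_ball_zero_iff]
  have hwv : 0 < w / v := div_pos hw hv
  rcases eq_or_ne x 0 with rfl | hx
  · have : (0 : ℝ≥0∞) ^ (-α) = ∞ := ENNReal.zero_rpow_of_neg (by linarith)
    simp [this, ENNReal.mul_top, hw, Real.rpow_pos_of_pos hwv]
  · have hn : 0 < ‖x‖ := norm_pos_iff.2 hx
    rw [← ofReal_norm, ENNReal.ofReal_rpow_of_pos hn, ← ENNReal.ofReal_mul hw.le,
      ENNReal.ofReal_lt_ofReal_iff_of_nonneg hv.le, Real.lt_rpow_inv_iff_of_pos hn.le hwv.le hα,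
      Real.rpow_neg hn.le, lt_div_iff₀ hv, ← div_eq_mul_inv, lt_div_iff₀ (Real.rpow_pos_of_pos hn _),
      mul_comm]

/-- The disc at level `v` has area `π (w / v)^(2/α)`, and integrating it against `e^(-v)` is Euler's
integral for `Γ(1 - 2/α)`, which converges because `α > 2`. -/
theorem lintegral_one_sub_expNeg_enorm_rpow {α w : ℝ} (hα : 2 < α) (hw : 0 ≤ w) :
    ∫⁻ x : EuclideanSpace ℝ (Fin 2), (1 - expNeg (ENNReal.ofReal w * ‖x‖ₑ ^ (-α))) =
      ENNReal.ofReal (Real.pi * Real.Gamma (1 - 2 / α) * w ^ (2 / α)) := by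
  have hα0 : 0 < α := by linarith
  have hδ : 0 < 1 - 2 / α := by
    rw [sub_pos, div_lt_one hα0]
    exact hα
  rcases hw.eq_or_lt with rfl | hw
  · have : (2 / α) ≠ 0 := by positivity
    simp [Real.zero_rpow this]
  have hpow : Measurable fun x : EuclideanSpace ℝ (Fin 2) => ENNReal.ofReal w * ‖x‖ₑ ^ (-α) := by
    fun_prop
  simp_rw [one_sub_expNeg_eq_lintegral]
  rw [lintegral_lintegral_swap]
  · have hinner : ∀ v ∈ Ioi (0 : ℝ), ∫⁻ x : EuclideanSpace ℝ (Fin 2),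
        {v : ℝ | ENNReal.ofReal v < ENNReal.ofReal w * ‖x‖ₑ ^ (-α)}.indicator
          (fun v => ENNReal.ofReal (Real.exp (-v))) v =
        ENNReal.ofReal (Real.pi * w ^ (2 / α)) *
          ENNReal.ofReal (Real.exp (-v) * v ^ (1 - 2 / α - 1)) := by
      intro v hv
      have hv : 0 < v := hv
      have h1 : ∀ x : EuclideanSpace ℝ (Fin 2),
          {v : ℝ | ENNReal.ofReal v < ENNReal.ofReal w * ‖x‖ₑ ^ (-α)}.indicator
          (fun v => ENNReal.ofReal (Real.exp (-v))) v =
          (Metric.ball 0 ((w / v) ^ α⁻¹)).indicator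
            (fun _ => ENNReal.ofReal (Real.exp (-v))) x := by
        intro x
        rw [← setOf_ofReal_lt_mul_enorm_rpow hα0 hw hv]
        rfl
      simp_rw [h1]
      rw [lintegral_indicator_const measurableSet_ball, EuclideanSpace.volume_ball_fin_two,
        ← ENNReal.ofReal_pow (by positivity), ← ENNReal.ofReal_mul (by positivity),
        ← ENNReal.ofReal_mul (by positivity), ← ENNReal.ofReal_mul (by positivity)]
      congr 1
      rw [← Real.rpow_mul_natCast (by positivity), Real.div_rpow hw.le hv.le,
        show 1 - 2 / α - 1 = -(2 / α) by ring, Real.rpow_neg hv.le]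
      push_cast
      rw [show α⁻¹ * 2 = 2 / α by ring]
      ring
    rw [setLIntegral_congr_fun measurableSet_Ioi hinner, lintegral_const_mul' _ _ (by simp),
      ← ofReal_integral_eq_lintegral_ofReal (Real.GammaIntegral_convergent hδ),
      ← Real.Gamma_eq_integral hδ, ← ENNReal.ofReal_mul (by positivity)]
    · congr 1
      ring
    · filter_upwards [ae_restrict_mem measurableSet_Ioi] with v hv
      have hv : 0 < v := hv
      exact (by positivity : (0 : ℝ) ≤ Real.exp (-v) * v ^ (1 - 2 / α - 1))
  · refine Measurable.aemeasurable ?_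
    have hset : MeasurableSet {p : EuclideanSpace ℝ (Fin 2) × ℝ |
        ENNReal.ofReal p.2 < ENNReal.ofReal w * ‖p.1‖ₑ ^ (-α)} :=
      measurableSet_lt (by fun_prop) (hpow.comp measurable_fst)
    exact (show Measurable fun p : EuclideanSpace ℝ (Fin 2) × ℝ =>
      ENNReal.ofReal (Real.exp (-p.2)) by fun_prop).indicator hset

/-! ### Fractional moments of combinations of two independent Gamma variables -/

/-- `E[(a X + b Y) ^ δ]` for independent `X`, `Y`, Gamma distributed with shape and rate `r`. -/
noncomputable def gammaMoment (δ r a b : ℝ) : ℝ :=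
  r ^ (-δ) * Real.Gamma (δ + 2 * r) / Real.Gamma r ^ 2 *
    ∫ u in (0 : ℝ)..1, u ^ (r - 1) * (1 - u) ^ (r - 1) * (a * (1 - u) + b * u) ^ δ

theorem measurable_gammaPDF (a r : ℝ) : Measurable (gammaPDF a r) :=
  (measurable_gammaPDFReal a r).ennreal_ofReal

/-- Change to the total `r = x + y` and the share `u = y / r`: a translation, then a scaling with
Jacobian `|r|`. The line `r = 0` is null. -/
theorem lintegral_lintegral_eq_radial {F : ℝ → ℝ → ℝ≥0∞} (hF : Measurable (Function.uncurry F)) :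
    ∫⁻ x, ∫⁻ y, F x y = ∫⁻ r, ∫⁻ u, ENNReal.ofReal |r| * F (r * (1 - u)) (r * u) := by
  have h1 : ∀ x, ∫⁻ y, F x y = ∫⁻ r, F x (r - x) := fun x =>
    (lintegral_sub_right_eq_self (fun y => F x y) x).symm
  simp_rw [h1]
  rw [lintegral_lintegral_swap]
  · refine lintegral_congr_ae ?_
    filter_upwards [Measure.ae_ne volume (0 : ℝ)] with r hr
    have hm : Measurable fun x => F x (r - x) :=
      hF.comp (measurable_id.prodMk (measurable_const.sub measurable_id))
    have h2 : ∫⁻ x, F x (r - x) = ∫⁻ x, F (r - x) x := by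
      rw [← lintegral_sub_left_eq_self (fun x => F x (r - x)) r]
      simp
    have hm' : Measurable fun x => F (r - x) x :=
      hF.comp ((measurable_const.sub measurable_id).prodMk measurable_id)
    have h3 := lintegral_map (μ := volume) hm' (measurable_const_mul r)
    rw [Real.map_volume_mul_left hr, lintegral_smul_measure] at h3
    have h4 : ∀ u, F (r * (1 - u)) (r * u) = F (r - r * u) (r * u) := fun u => by
      rw [mul_sub, mul_one]
    simp_rw [h4]
    rw [lintegral_const_mul' _ _ ENNReal.ofReal_ne_top, h2, ← h3, smul_eq_mul, ← mul_assoc,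
      ← ENNReal.ofReal_mul (abs_nonneg _), ← abs_mul, mul_inv_cancel₀ hr]
    simp
  · exact (hF.comp (measurable_fst.prodMk (measurable_snd.sub measurable_fst))).aemeasurable

theorem intervalIntegrable_beta_mul_rpow {r δ a b : ℝ} (hr : 0 < r) (hδ : 0 ≤ δ) :
    IntervalIntegrable
      (fun u : ℝ => u ^ (r - 1) * (1 - u) ^ (r - 1) * (a * (1 - u) + b * u) ^ δ) volume 0 1 := by
  refine (integral_beta hr hr).1.mul_continuousOn ?_
  refine ContinuousOn.rpow_const (by fun_prop) fun u _ => Or.inr hδ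

/-- In total and share the exponentials of the two densities depend on the total only, and the
powers factor. The total contributes a Gamma integral of argument `δ + 2r`, the share the integral
in `gammaMoment`. -/
theorem lintegral_gamma_rpow {δ r a b : ℝ} (hδ : 0 < δ) (hr : 0 < r) (ha : 0 ≤ a) (hb : 0 ≤ b) :
    ∫⁻ x, ∫⁻ y, ENNReal.ofReal ((a * x + b * y) ^ δ) ∂(gammaMeasure r r) ∂(gammaMeasure r r) =
      ENNReal.ofReal (gammaMoment δ r a b) := by
  set C : ℝ := r ^ r / Real.Gamma r with hC
  have hC0 : 0 < C := div_pos (Real.rpow_pos_of_pos hr _) (Real.Gamma_pos_of_pos hr)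
  have hpdf := measurable_gammaPDF r r
  have hm : Measurable fun p : ℝ × ℝ => ENNReal.ofReal ((a * p.1 + b * p.2) ^ δ) := by fun_prop
  have h1 : ∀ x, ∫⁻ y, ENNReal.ofReal ((a * x + b * y) ^ δ) ∂(gammaMeasure r r) =
      ∫⁻ y, gammaPDF r r y * ENNReal.ofReal ((a * x + b * y) ^ δ) := fun x => by
    rw [gammaMeasure, lintegral_withDensity_eq_lintegral_mul _ hpdf
      (show Measurable fun y => ENNReal.ofReal ((a * x + b * y) ^ δ) by fun_prop)]
    rfl
  have hm2 : Measurable fun p : ℝ × ℝ =>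
      gammaPDF r r p.2 * ENNReal.ofReal ((a * p.1 + b * p.2) ^ δ) :=
    (hpdf.comp measurable_snd).mul hm
  simp_rw [h1]
  rw [gammaMeasure, lintegral_withDensity_eq_lintegral_mul _ hpdf hm2.lintegral_prod_right']
  simp only [Pi.mul_apply]
  have h2 : ∀ x, gammaPDF r r x * ∫⁻ y, gammaPDF r r y * ENNReal.ofReal ((a * x + b * y) ^ δ) =
      ∫⁻ y, gammaPDF r r x * (gammaPDF r r y * ENNReal.ofReal ((a * x + b * y) ^ δ)) := fun x =>
    (lintegral_const_mul _ (hm2.comp measurable_prodMk_left)).symm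
  simp_rw [h2]
  rw [lintegral_lintegral_eq_radial (F := fun x y => gammaPDF r r x *
    (gammaPDF r r y * ENNReal.ofReal ((a * x + b * y) ^ δ))) ((hpdf.comp measurable_fst).mul hm2)]
  set R : ℝ → ℝ := fun ρ => C ^ 2 * (ρ ^ (δ + 2 * r - 1) * Real.exp (-(r * ρ))) with hR
  set U : ℝ → ℝ := fun u => u ^ (r - 1) * (1 - u) ^ (r - 1) * (a * (1 - u) + b * u) ^ δ with hU
  -- The densities vanish unless `ρ > 0` and `0 < u < 1`; there the integrand is a product of `R ρ`
  -- and `U u`.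
  have hinner : ∀ᵐ ρ : ℝ, ∫⁻ u, ENNReal.ofReal |ρ| * (gammaPDF r r (ρ * (1 - u)) *
      (gammaPDF r r (ρ * u) * ENNReal.ofReal ((a * (ρ * (1 - u)) + b * (ρ * u)) ^ δ))) =
      (Ioi (0 : ℝ)).indicator (fun ρ => ENNReal.ofReal (R ρ)) ρ *
        ∫⁻ u in Ioo (0 : ℝ) 1, ENNReal.ofReal (U u) := by
    filter_upwards [Measure.ae_ne volume (0 : ℝ)] with ρ hρ
    rcases hρ.lt_or_gt with hρ | hρ
    · rw [Set.indicator_of_notMem (by simpa using hρ.le), zero_mul]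
      refine (lintegral_congr fun u => ?_).trans lintegral_zero
      rcases lt_or_ge 0 u with hu | hu
      · rw [gammaPDF_of_neg (mul_neg_of_neg_of_pos hρ hu)]
        simp
      · rw [gammaPDF_of_neg (mul_neg_of_neg_of_pos hρ (by linarith : 0 < 1 - u))]
        simp
    · rw [Set.indicator_of_mem (by simpa using hρ), ← lintegral_const_mul' _ _ (by simp),
        ← lintegral_indicator measurableSet_Ioo]
      refine lintegral_congr_ae ?_
      filter_upwards [Measure.ae_ne volume (0 : ℝ), Measure.ae_ne volume (1 : ℝ)] with u hu0 hu1
      by_cases hu : u ∈ Ioo (0 : ℝ) 1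
      · rw [Set.indicator_of_mem hu]
        have hu1 : 0 < 1 - u := by linarith [hu.2]
        have hu0 := hu.1
        rw [gammaPDF_of_nonneg (by positivity), gammaPDF_of_nonneg (by positivity),
          ← ENNReal.ofReal_mul (by positivity), ← ENNReal.ofReal_mul (by positivity),
          ← ENNReal.ofReal_mul (by positivity), ← ENNReal.ofReal_mul (by positivity)]
        congr 1
        rw [show a * (ρ * (1 - u)) + b * (ρ * u) = ρ * (a * (1 - u) + b * u) by ring,
          Real.mul_rpow hρ.le hu1.le, Real.mul_rpow hρ.le hu0.le,
          Real.mul_rpow hρ.le (show 0 ≤ a * (1 - u) + b * u by positivity), abs_of_pos hρ]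
        simp only [hR, hU]
        have he : Real.exp (-(r * ρ)) =
            Real.exp (-(r * (ρ * (1 - u)))) * Real.exp (-(r * (ρ * u))) := by
          rw [← Real.exp_add]
          ring_nf
        have hp : ρ ^ (δ + 2 * r - 1) = ρ * ρ ^ (r - 1) * ρ ^ (r - 1) * ρ ^ δ := by
          nth_rewrite 2 [← Real.rpow_one ρ]
          rw [← Real.rpow_add hρ, ← Real.rpow_add hρ, ← Real.rpow_add hρ]
          ring_nf
        rw [he, hp]
        ring
      · rw [Set.indicator_of_notMem hu]
        rcases lt_or_ge u 0 with h | h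
        · rw [gammaPDF_of_neg (mul_neg_of_pos_of_neg hρ h)]
          simp
        · have : 1 < u := lt_of_le_of_ne (not_lt.1 fun h' => hu ⟨h.lt_of_ne' hu0, h'⟩) hu1.symm
          rw [gammaPDF_of_neg (mul_neg_of_pos_of_neg hρ (by linarith : 1 - u < 0))]
          simp
  have hRint : IntegrableOn (fun ρ : ℝ => ρ ^ (δ + 2 * r - 1) * Real.exp (-(r * ρ))) (Ioi 0) := by
    have := integrableOn_rpow_mul_exp_neg_mul_rpow (s := δ + 2 * r - 1) (p := 1) (b := r)
      (by linarith) one_pos hr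
    simpa [neg_mul] using this
  have hUint := intervalIntegrable_beta_mul_rpow (a := a) (b := b) hr hδ.le
  rw [intervalIntegrable_iff_integrableOn_Ioo_of_le zero_le_one] at hUint
  have hUnn : ∀ u ∈ Ioo (0 : ℝ) 1, 0 ≤ U u := by
    intro u hu
    have hu1 : 0 < 1 - u := by linarith [hu.2]
    have hu0 := hu.1
    simp only [hU]
    positivity
  refine (lintegral_congr_ae hinner).trans ?_
  rw [lintegral_mul_const _ (Measurable.indicator (by fun_prop) measurableSet_Ioi),
    lintegral_indicator measurableSet_Ioi,
    ← ofReal_integral_eq_lintegral_ofReal (hRint.const_mul _) _,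
    ← ofReal_integral_eq_lintegral_ofReal hUint _, ← ENNReal.ofReal_mul]
  · congr 1
    rw [integral_const_mul, Real.integral_rpow_mul_exp_neg_mul_Ioi (by positivity) hr, gammaMoment,
      intervalIntegral.integral_of_le zero_le_one, ← integral_Ioc_eq_integral_Ioo]
    change _ = _ * ∫ u in Ioc (0 : ℝ) 1, U u
    generalize (∫ u in Ioc (0 : ℝ) 1, U u) = J
    rw [hC, one_div, Real.inv_rpow hr.le, ← Real.rpow_neg hr.le,
      show -(δ + 2 * r) = -δ + -r + -r by ring, Real.rpow_add hr, Real.rpow_add hr,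
      Real.rpow_neg hr.le r]
    have h2 := (Real.rpow_pos_of_pos hr r).ne'
    have h3 := (Real.Gamma_pos_of_pos hr).ne'
    field_simp
  · exact setIntegral_nonneg measurableSet_Ioi fun ρ hρ => by
      have hρ : 0 < ρ := hρ
      positivity
  · filter_upwards [ae_restrict_mem measurableSet_Ioo] with u hu using hUnn u hu
  · filter_upwards [ae_restrict_mem measurableSet_Ioi] with ρ hρ
    have hρ : 0 < ρ := hρ
    exact (by positivity : (0 : ℝ) ≤ C ^ 2 * (ρ ^ (δ + 2 * r - 1) * Real.exp (-(r * ρ))))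

theorem gammaMoment_nonneg {δ r a b : ℝ} (hδ : 0 < δ) (hr : 0 < r) (ha : 0 ≤ a) (hb : 0 ≤ b) :
    0 ≤ gammaMoment δ r a b := by
  have h1 := Real.Gamma_pos_of_pos (show 0 < δ + 2 * r by positivity)
  have h2 : 0 ≤ ∫ u in (0 : ℝ)..1,
      u ^ (r - 1) * (1 - u) ^ (r - 1) * (a * (1 - u) + b * u) ^ δ := by
    refine intervalIntegral.integral_nonneg zero_le_one fun u hu => ?_
    have hu1 : 0 ≤ 1 - u := by linarith [hu.2]
    have hu0 := hu.1
    positivity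
  unfold gammaMoment
  positivity

/-- With one weight zero the integral is a Beta integral. This is the case `z ≥ T` of `calA`, and
also gives the Laplace transform of a single antenna's interference. -/
theorem gammaMoment_zero_left {δ r b : ℝ} (hδ : 0 < δ) (hr : 0 < r) (hb : 0 ≤ b) :
    gammaMoment δ r 0 b = r ^ (-δ) * b ^ δ * (Real.Gamma (δ + r) / Real.Gamma r) := by
  have hI : ∫ u in (0 : ℝ)..1, u ^ (r - 1) * (1 - u) ^ (r - 1) * (0 * (1 - u) + b * u) ^ δ =
      b ^ δ * (Real.Gamma (δ + r) * Real.Gamma r / Real.Gamma (δ + r + r)) := by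
    rw [← (integral_beta (show 0 < δ + r by positivity) hr).2,
      ← intervalIntegral.integral_const_mul]
    refine intervalIntegral.integral_congr_ae (ae_of_all _ fun u hu => ?_)
    rw [uIoc_of_le zero_le_one] at hu
    rw [zero_mul, zero_add, Real.mul_rpow hb hu.1.le, show δ + r - 1 = r - 1 + δ by ring,
      Real.rpow_add hu.1]
    ring
  rw [gammaMoment, hI, show δ + r + r = δ + 2 * r by ring]
  have h1 := (Real.Gamma_pos_of_pos (show 0 < δ + 2 * r by positivity)).ne'
  have h3 := (Real.Gamma_pos_of_pos hr).ne'
  field_simp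

/-- Pulling `a` out of `a (1 - u) + b u = a (1 - (1 - b / a) u)` leaves Euler's integral, with `c =
2r` because both exponents equal `r - 1`. -/
theorem gammaMoment_eq_regHypergeometric {δ r a b : ℝ} (ha : 0 < a)
    (hb : 0 ≤ b) :
    gammaMoment δ r a b = r ^ (-δ) * Real.Gamma (δ + 2 * r) *
      (a ^ δ * regHypergeometric (-δ) r (2 * r) (1 - b / a)) := by
  have hI : ∫ u in (0 : ℝ)..1, u ^ (r - 1) * (1 - u) ^ (r - 1) * (a * (1 - u) + b * u) ^ δ =
      a ^ δ * ∫ u in (0 : ℝ)..1,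
        u ^ (r - 1) * (1 - u) ^ (2 * r - r - 1) * (1 - (1 - b / a) * u) ^ (- -δ) := by
    rw [← intervalIntegral.integral_const_mul]
    refine intervalIntegral.integral_congr fun u hu => ?_
    rw [uIcc_of_le zero_le_one] at hu
    have h1 : a * (1 - u) + b * u = a * (1 - (1 - b / a) * u) := by
      field_simp
      ring
    have h2 : 0 ≤ 1 - (1 - b / a) * u := by
      have : 0 ≤ b / a * u := mul_nonneg (by positivity) hu.1
      nlinarith [hu.2]
    rw [h1, Real.mul_rpow ha.le h2, neg_neg, show 2 * r - r - 1 = r - 1 by ring]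
    ring
  rw [gammaMoment, hI, regHypergeometric, show 2 * r - r = r by ring]
  ring

/-- Unifies the two branches of `calA`: for `z ≥ T` the first weight is zero and the moment reduces
to a quotient of Gamma values. -/
theorem calA_eq_gammaMoment {α d mI T z s t : ℝ} {mD : ℕ} (hα : 0 < α) (hmI : 0 < mI)
    (hmD : 0 < mD) (hz : 0 < z) (hs : 0 < s) (ht : 0 < t) :
    calA α d mD mI T z s t = d ^ 2 * Real.Gamma (1 - 2 / α) *
      gammaMoment (2 / α) mI (s * (mD * max 0 (T - z))) (t * (mD * z)) := by
  have hδ : 0 < 2 / α := by positivity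
  have hm : (0 : ℝ) < mD := by exact_mod_cast hmD
  unfold calA
  split_ifs with h
  · have hTz : 0 < T - z := sub_pos.2 h
    rw [max_eq_right hTz.le, gammaMoment_eq_regHypergeometric (by positivity) (by positivity),
      Real.mul_rpow hs.le (by positivity), Real.mul_rpow hm.le hTz.le,
      Real.div_rpow hm.le hmI.le, Real.rpow_neg hmI.le,
      show t * (mD * z) / (s * (mD * (T - z))) = z * t / ((T - z) * s) by field_simp]
    have := (Real.rpow_pos_of_pos hmI (2 / α)).ne'
    field_simp
  · rw [max_eq_left (by linarith), mul_zero, mul_zero,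
      gammaMoment_zero_left hδ hmI (by positivity), show t * (mD * z) = z * t * mD by ring,
      Real.mul_rpow (by positivity) hm.le, Real.div_rpow hm.le hmI.le, Real.rpow_neg hmI.le]
    have := (Real.rpow_pos_of_pos hmI (2 / α)).ne'
    field_simp

/-! ### Independence -/

theorem lintegral_eq_lintegral_lintegral_of_indepFun {Ω β γ : Type*} [MeasurableSpace Ω]
    [MeasurableSpace β] [MeasurableSpace γ] {P : Measure Ω} [IsProbabilityMeasure P] {X : Ω → β}
    {Y : Ω → γ} (hXY : IndepFun X Y P) (hX : Measurable X) (hY : Measurable Y)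
    {F : β → γ → ℝ≥0∞} (hF : Measurable (Function.uncurry F)) :
    ∫⁻ ω, F (X ω) (Y ω) ∂P = ∫⁻ ω, ∫⁻ ω', F (X ω) (Y ω') ∂P ∂P := by
  have h := (indepFun_iff_map_prod_eq_prod_map_map hX.aemeasurable hY.aemeasurable).1 hXY
  have := Measure.isProbabilityMeasure_map (μ := P) hY.aemeasurable
  have h1 := lintegral_map (μ := P) hF (hX.prodMk hY)
  rw [h, lintegral_prod _ hF.aemeasurable, lintegral_map hF.lintegral_prod_right' hX] at h1
  refine h1.symm.trans (lintegral_congr fun ω => ?_)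
  exact lintegral_map (hF.comp measurable_prodMk_left) hY

theorem iIndepFun.indepFun_of_disjoint {Ω ι κ κ' β : Type*} [MeasurableSpace Ω]
    [MeasurableSpace β] {P : Measure Ω} {f : ι → Ω → β} (hf : iIndepFun f P)
    (hfm : ∀ i, Measurable (f i)) {u : κ → ι} {v : κ' → ι} (huv : ∀ i j, u i ≠ v j) :
    IndepFun (fun ω i => f (u i) ω) (fun ω j => f (v j) ω) P := by
  have h := indep_iSup_of_disjoint (fun i => (hfm i).comap_le) ((iIndepFun_iff_iIndep _ _ _).1 hf)
    (S := range u) (T := range v) (by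
      rw [Set.disjoint_left]
      rintro _ ⟨i, rfl⟩ ⟨j, hj⟩
      exact huv i j hj.symm)
  rw [IndepFun_iff_Indep]
  refine indep_of_indep_of_le_left (indep_of_indep_of_le_right h ?_) ?_ <;>
  · simp only [MeasurableSpace.pi, MeasurableSpace.comap_iSup, MeasurableSpace.comap_comp]
    refine iSup_le fun i => ?_
    exact le_iSup₂_of_le _ (mem_range_self i) le_rfl

theorem ae_nonneg_gammaMeasure (a r : ℝ) : ∀ᵐ y ∂(gammaMeasure a r), 0 ≤ y := by
  rw [gammaMeasure, ae_withDensity_iff (measurable_gammaPDF a r)]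
  refine ae_of_all _ fun y hy => ?_
  by_contra h
  exact hy (gammaPDF_of_neg (not_le.1 h))

instance sigmaFinite_ofReal_smul {E : Type*} [MeasurableSpace E] (μ : Measure E) [SigmaFinite μ]
    (c : ℝ) : SigmaFinite (ENNReal.ofReal c • μ) := by
  rw [← withDensity_const]
  exact SigmaFinite.withDensity (fun _ => c.toNNReal)

/-! ### The interference -/

section Network

variable {Ω : Type*} [MeasurableSpace Ω] {P : Measure Ω} {lam : ℝ} {mD : ℕ} {mI : ℝ}
  {x : ℕ → Ω → EuclideanSpace ℝ (Fin 2)} {g : Fin 2 → Ω → ℝ} {h : Fin 2 → ℕ → Ω → ℝ}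

theorem IsNetwork.measurable_fading (hn : IsNetwork P lam mD mI x g h) (j) :
    Measurable (fading g h j) := by
  rcases j with n | p
  · exact hn.measurable_g n
  · exact hn.measurable_h p.1 p.2

/-- `E exp(-w h)` for a Gamma distributed gain `h`. -/
noncomputable def gammaLaplace (r : ℝ) (w : ℝ≥0∞) : ℝ≥0∞ :=
  ∫⁻ y, expNeg (w * ENNReal.ofReal y) ∂(gammaMeasure r r)

theorem measurable_gammaLaplace {r : ℝ} (hr : 0 < r) : Measurable (gammaLaplace r) := by
  have := isProbabilityMeasure_gammaMeasure hr hr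
  have hm : Measurable fun p : ℝ≥0∞ × ℝ => expNeg (p.1 * ENNReal.ofReal p.2) := by fun_prop
  exact hm.lintegral_prod_right'

theorem gammaLaplace_le_one {r : ℝ} (hr : 0 < r) (w : ℝ≥0∞) : gammaLaplace r w ≤ 1 := by
  have := isProbabilityMeasure_gammaMeasure hr hr
  refine (lintegral_mono fun y => expNeg_le_one _).trans ?_
  simp

/-- For frozen positions, finite products factor by independence and the infinite one follows by
dominated convergence. The result is stated with `negLog` to suit the generating functional. -/
theorem IsNetwork.lintegral_expNeg_fading (hn : IsNetwork P lam mD mI x g h) (hmI : 0 < mI)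
    (w : Fin 2 → ℝ≥0∞) (c : ℕ → ℝ≥0∞) :
    ∫⁻ ω, expNeg (∑' i, (∑ n, w n * ENNReal.ofReal (h n i ω)) * c i) ∂P =
      expNeg (∑' i, negLog (gammaLaplace mI (w 0 * c i) * gammaLaplace mI (w 1 * c i))) := by
  have := hn.isProbabilityMeasure
  set X : ℕ × Fin 2 → Ω → ℝ≥0∞ := fun p ω => expNeg (w p.2 * c p.1 * ENNReal.ofReal (h p.2 p.1 ω))
  have hXm : ∀ p, Measurable (X p) := fun p =>
    measurable_expNeg.comp ((hn.measurable_h p.2 p.1).ennreal_ofReal.const_mul _)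
  have hind : iIndepFun X P :=
    (hn.indep_fading.precomp (g := fun p : ℕ × Fin 2 => Sum.inr (p.2, p.1)) (by
      rintro ⟨i, n⟩ ⟨j, m⟩ hp
      simp_all)).comp (fun p y => expNeg (w p.2 * c p.1 * ENNReal.ofReal y)) (fun p => by fun_prop)
  have hX : ∀ p, ∫⁻ ω, X p ω ∂P = gammaLaplace mI (w p.2 * c p.1) := by
    intro p
    rw [gammaLaplace, ← hn.law_h p.2 p.1, lintegral_map (by fun_prop) (hn.measurable_h p.2 p.1)]
  have hprod : ∀ (N : ℕ) (ω : Ω), ∏ i ∈ Finset.range N,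
      expNeg ((∑ n, w n * ENNReal.ofReal (h n i ω)) * c i) =
      ∏ p ∈ Finset.range N ×ˢ Finset.univ, X p ω := by
    intro N ω
    rw [Finset.prod_product]
    refine Finset.prod_congr rfl fun i _ => ?_
    rw [Finset.sum_mul, expNeg_sum]
    refine Finset.prod_congr rfl fun n _ => ?_
    rw [mul_right_comm]
  have hL : Tendsto (fun N => ∫⁻ ω, ∏ i ∈ Finset.range N,
      expNeg ((∑ n, w n * ENNReal.ofReal (h n i ω)) * c i) ∂P) atTop
      (𝓝 (∫⁻ ω, expNeg (∑' i, (∑ n, w n * ENNReal.ofReal (h n i ω)) * c i) ∂P)) := by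
    refine tendsto_lintegral_of_dominated_convergence (fun _ => 1) (fun N => ?_)
      (fun N => ae_of_all _ fun ω => ?_) (by simp) (ae_of_all _ fun ω => tendsto_prod_expNeg _)
    · simp_rw [hprod]
      exact Finset.measurable_prod _ fun p _ => hXm p
    · exact Finset.prod_le_one' fun i _ => expNeg_le_one _
  refine tendsto_nhds_unique hL ((tendsto_prod_expNeg _).congr fun N => ?_)
  simp_rw [hprod]
  rw [lintegral_prod_eq_prod_lintegral_of_indepFun _ X hind hXm, Finset.prod_product]
  refine Finset.prod_congr rfl fun i _ => ?_
  rw [expNeg_negLog (mul_le_one' (gammaLaplace_le_one hmI _) (gammaLaplace_le_one hmI _)),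
    Fin.prod_univ_two, hX, hX]

/-- Undoes the averaging over the two gains, so that Tonelli can carry out the spatial integral
first, for fixed gains. -/
theorem one_sub_gammaLaplace_mul {r : ℝ} (hr : 0 < r) (w₀ w₁ c : ℝ≥0∞) :
    1 - gammaLaplace r (w₀ * c) * gammaLaplace r (w₁ * c) =
      ∫⁻ y, ∫⁻ y', (1 - expNeg ((w₀ * ENNReal.ofReal y + w₁ * ENNReal.ofReal y') * c))
        ∂(gammaMeasure r r) ∂(gammaMeasure r r) := by
  have := isProbabilityMeasure_gammaMeasure hr hr
  have hm : Measurable fun p : ℝ × ℝ =>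
    expNeg ((w₀ * ENNReal.ofReal p.1 + w₁ * ENNReal.ofReal p.2) * c) := by fun_prop
  have hfin : ∀ F : ℝ → ℝ≥0∞, (∀ y, F y ≤ 1) → ∫⁻ y, F y ∂(gammaMeasure r r) ≤ 1 := by
    intro F hF
    refine (lintegral_mono hF).trans ?_
    simp
  have h1 : ∀ y, ∫⁻ y', (1 - expNeg ((w₀ * ENNReal.ofReal y + w₁ * ENNReal.ofReal y') * c))
      ∂(gammaMeasure r r) = 1 - expNeg (w₀ * c * ENNReal.ofReal y) * gammaLaplace r (w₁ * c) := by
    intro y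
    have hmy : Measurable fun y' : ℝ =>
        expNeg ((w₀ * ENNReal.ofReal y + w₁ * ENNReal.ofReal y') * c) := by fun_prop
    rw [lintegral_sub hmy
      ((hfin _ fun _ => expNeg_le_one _).trans_lt (by simp)).ne
      (ae_of_all _ fun _ => expNeg_le_one _), gammaLaplace, ← lintegral_const_mul _ (by fun_prop)]
    simp_rw [← expNeg_add]
    rw [lintegral_const, measure_univ, mul_one]
    congr 2
    funext y'
    congr 1
    ring
  simp_rw [h1]
  rw [lintegral_sub (by fun_prop)
    ((hfin _ fun y => mul_le_one' (expNeg_le_one _) (gammaLaplace_le_one hr _)).trans_lt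
      (by simp)).ne
    (ae_of_all _ fun y => mul_le_one' (expNeg_le_one _) (gammaLaplace_le_one hr _)),
    lintegral_mul_const _ (by fun_prop), lintegral_const, measure_univ, mul_one]
  rfl

/-- For fixed gains the spatial integral is a multiple of `((a y + b y') d^α)^(2/α)`. The distance
contributes `d ^ 2`, and averaging over the gains leaves their fractional moment. -/
theorem lintegral_one_sub_gammaLaplace_mul {α d a b : ℝ} (hα : 2 < α) (hd : 0 < d)
    (hmI : 0 < mI) (ha : 0 ≤ a) (hb : 0 ≤ b) :
    ∫⁻ y : EuclideanSpace ℝ (Fin 2),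
      (1 - gammaLaplace mI (ENNReal.ofReal a * (ENNReal.ofReal (d ^ α) * ‖y‖ₑ ^ (-α))) *
        gammaLaplace mI (ENNReal.ofReal b * (ENNReal.ofReal (d ^ α) * ‖y‖ₑ ^ (-α)))) =
      ENNReal.ofReal (Real.pi * (d ^ 2 * Real.Gamma (1 - 2 / α) * gammaMoment (2 / α) mI a b)) := by
  have := isProbabilityMeasure_gammaMeasure hmI hmI
  have hα0 : 0 < α := by linarith
  have hδ : 0 < 1 - 2 / α := by
    rw [sub_pos, div_lt_one hα0]
    exact hα
  have hΓ := Real.Gamma_pos_of_pos hδ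
  simp_rw [one_sub_gammaLaplace_mul hmI]
  have hm : Measurable fun p : (EuclideanSpace ℝ (Fin 2) × ℝ) × ℝ =>
      1 - expNeg ((ENNReal.ofReal a * ENNReal.ofReal p.1.2 +
        ENNReal.ofReal b * ENNReal.ofReal p.2) * (ENNReal.ofReal (d ^ α) * ‖p.1.1‖ₑ ^ (-α))) := by
    fun_prop
  rw [lintegral_lintegral_swap hm.lintegral_prod_right'.aemeasurable]
  have hpt : ∀ᵐ y ∂(gammaMeasure mI mI), ∫⁻ z : EuclideanSpace ℝ (Fin 2), ∫⁻ y',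
      (1 - expNeg ((ENNReal.ofReal a * ENNReal.ofReal y + ENNReal.ofReal b * ENNReal.ofReal y') *
        (ENNReal.ofReal (d ^ α) * ‖z‖ₑ ^ (-α)))) ∂(gammaMeasure mI mI) =
      ∫⁻ y', ENNReal.ofReal (Real.pi * (d ^ 2 * Real.Gamma (1 - 2 / α))) *
        ENNReal.ofReal ((a * y + b * y') ^ (2 / α)) ∂(gammaMeasure mI mI) := by
    filter_upwards [ae_nonneg_gammaMeasure mI mI] with y hy
    have hmy : Measurable (Function.uncurry fun (z : EuclideanSpace ℝ (Fin 2)) (y' : ℝ) =>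
        1 - expNeg ((ENNReal.ofReal a * ENNReal.ofReal y + ENNReal.ofReal b * ENNReal.ofReal y') *
          (ENNReal.ofReal (d ^ α) * ‖z‖ₑ ^ (-α)))) := by
      unfold Function.uncurry
      fun_prop
    rw [lintegral_lintegral_swap hmy.aemeasurable]
    refine lintegral_congr_ae ?_
    filter_upwards [ae_nonneg_gammaMeasure mI mI] with y' hy'
    have hw : 0 ≤ (a * y + b * y') * d ^ α := by positivity
    have hrw : ∀ z : EuclideanSpace ℝ (Fin 2),
        (ENNReal.ofReal a * ENNReal.ofReal y + ENNReal.ofReal b * ENNReal.ofReal y') *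
        (ENNReal.ofReal (d ^ α) * ‖z‖ₑ ^ (-α)) =
        ENNReal.ofReal ((a * y + b * y') * d ^ α) * ‖z‖ₑ ^ (-α) := by
      intro z
      rw [ENNReal.ofReal_mul (by positivity), ENNReal.ofReal_add (by positivity) (by positivity),
        ENNReal.ofReal_mul ha, ENNReal.ofReal_mul hb, mul_assoc]
    simp_rw [hrw]
    rw [lintegral_one_sub_expNeg_enorm_rpow hα hw, ← ENNReal.ofReal_mul (by positivity)]
    congr 1
    rw [Real.mul_rpow (by positivity) (by positivity), ← Real.rpow_mul hd.le,
      mul_div_cancel₀ _ hα0.ne', Real.rpow_two]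
    ring
  rw [lintegral_congr_ae hpt]
  have hm2 : Measurable fun p : ℝ × ℝ => ENNReal.ofReal ((a * p.1 + b * p.2) ^ (2 / α)) := by
    fun_prop
  simp_rw [lintegral_const_mul' _ _ ENNReal.ofReal_ne_top]
  rw [lintegral_gamma_rpow (by positivity) hmI ha hb, ← ENNReal.ofReal_mul (by positivity)]
  congr 1
  ring

theorem measurable_interference_kernel (α d : ℝ) :
    Measurable fun p : (ℕ → EuclideanSpace ℝ (Fin 2)) × (ℕ → ℝ) =>
      ENNReal.ofReal (d ^ α) * ∑' i, ENNReal.ofReal (p.2 i) * ‖p.1 i‖ₑ ^ (-α) := by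
  refine (Measurable.tsum fun i => ?_).const_mul _
  fun_prop

theorem IsNetwork.measurable_interference (hn : IsNetwork P lam mD mI x g h) (α d : ℝ)
    (n : Fin 2) : Measurable (interference α d x (h n)) :=
  (measurable_interference_kernel α d).comp
    ((measurable_pi_lambda _ fun i => hn.points.measurable i).prodMk
      (measurable_pi_lambda _ fun i => hn.measurable_h n i))

/-- Joint Laplace transform of the interference powers at the two antennas. -/
theorem IsNetwork.lintegral_expNeg_interference (hn : IsNetwork P lam mD mI x g h) {α d a b : ℝ}
    (hα : 2 < α) (hd : 0 < d) (hmI : 0 < mI) (hlam : 0 ≤ lam) (ha : 0 ≤ a) (hb : 0 ≤ b) :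
    ∫⁻ ω, expNeg (ENNReal.ofReal a * interference α d x (h 0) ω +
      ENNReal.ofReal b * interference α d x (h 1) ω) ∂P =
      expNeg (ENNReal.ofReal (Real.pi * lam *
        (d ^ 2 * Real.Gamma (1 - 2 / α) * gammaMoment (2 / α) mI a b))) := by
  have := hn.isProbabilityMeasure
  set c : EuclideanSpace ℝ (Fin 2) → ℝ≥0∞ := fun y => ENNReal.ofReal (d ^ α) * ‖y‖ₑ ^ (-α) with hc
  have hcm : Measurable c := by fun_prop
  set w : Fin 2 → ℝ≥0∞ := ![ENNReal.ofReal a, ENNReal.ofReal b] with hw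
  have hrw : ∀ ω, ENNReal.ofReal a * interference α d x (h 0) ω +
      ENNReal.ofReal b * interference α d x (h 1) ω =
      ∑' i, (∑ n, w n * ENNReal.ofReal (h n i ω)) * c (x i ω) := by
    intro ω
    simp only [interference, ← ENNReal.tsum_mul_left, ← ENNReal.tsum_add]
    refine tsum_congr fun i => ?_
    simp only [Fin.sum_univ_two, hw, hc, Matrix.cons_val_zero, Matrix.cons_val_one]
    ring
  simp_rw [hrw]
  -- The fading is averaged first with the points frozen; the points are then averaged by the
  -- generating functional.
  refine (lintegral_eq_lintegral_lintegral_of_indepFun hn.indep_points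
    (measurable_pi_lambda _ fun i => hn.points.measurable i)
    (measurable_pi_lambda _ fun j => hn.measurable_fading j)
    (F := fun xs fs => expNeg
      (∑' i, (∑ n, w n * ENNReal.ofReal (fs (Sum.inr (n, i)))) * c (xs i))) ?_).trans ?_
  · refine measurable_expNeg.comp (Measurable.tsum fun i => ?_)
    fun_prop
  · have hin := fun ω => hn.lintegral_expNeg_fading hmI w (fun i => c (x i ω))
    simp only [fading, Sum.elim_inr]
    simp_rw [hin]
    have hm : Measurable fun y => gammaLaplace mI (w 0 * c y) * gammaLaplace mI (w 1 * c y) :=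
      ((measurable_gammaLaplace hmI).comp (hcm.const_mul _)).mul
        ((measurable_gammaLaplace hmI).comp (hcm.const_mul _))
    rw [hn.points.lintegral_expNeg_tsum_negLog hm
      (fun y => mul_le_one' (gammaLaplace_le_one hmI _) (gammaLaplace_le_one hmI _)),
      lintegral_smul_measure]
    have := lintegral_one_sub_gammaLaplace_mul hα hd hmI ha hb
    simp only [hw, hc, Matrix.cons_val_zero, Matrix.cons_val_one]
    rw [this, smul_eq_mul, ← ENNReal.ofReal_mul hlam]
    ring_nf

/-- The desired gains are independent of each other and of the interference. -/
theorem IsNetwork.lintegral_interference_gains (hn : IsNetwork P lam mD mI x g h) (hmD : 0 < mD)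
    (α d : ℝ) {ψ : ℝ≥0∞ × ℝ≥0∞ → ℝ → ℝ → ℝ≥0∞}
    (hψ : Measurable fun p : (ℝ≥0∞ × ℝ≥0∞) × ℝ × ℝ => ψ p.1 p.2.1 p.2.2) :
    ∫⁻ ω, ψ (interference α d x (h 0) ω, interference α d x (h 1) ω) (g 0 ω) (g 1 ω) ∂P =
      ∫⁻ ω, ∫⁻ y', ∫⁻ y, ψ (interference α d x (h 0) ω, interference α d x (h 1) ω) y y'
        ∂(gammaMeasure mD mD) ∂(gammaMeasure mD mD) ∂P := by
  have := hn.isProbabilityMeasure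
  have hm : (0 : ℝ) < mD := by exact_mod_cast hmD
  have := isProbabilityMeasure_gammaMeasure hm hm
  set J : (ℕ → EuclideanSpace ℝ (Fin 2)) → (Fin 2 × ℕ → ℝ) → ℝ≥0∞ × ℝ≥0∞ := fun xs hs =>
    (ENNReal.ofReal (d ^ α) * ∑' i, ENNReal.ofReal (hs (0, i)) * ‖xs i‖ₑ ^ (-α),
      ENNReal.ofReal (d ^ α) * ∑' i, ENNReal.ofReal (hs (1, i)) * ‖xs i‖ₑ ^ (-α))
  have hJ : Measurable (Function.uncurry J) :=
    ((measurable_interference_kernel α d).comp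
      (show Measurable fun p : (ℕ → EuclideanSpace ℝ (Fin 2)) × (Fin 2 × ℕ → ℝ) =>
        (p.1, fun i => p.2 (0, i)) by fun_prop)).prodMk
    ((measurable_interference_kernel α d).comp
      (show Measurable fun p : (ℕ → EuclideanSpace ℝ (Fin 2)) × (Fin 2 × ℕ → ℝ) =>
        (p.1, fun i => p.2 (1, i)) by fun_prop))
  set X : Ω → ℕ → EuclideanSpace ℝ (Fin 2) := fun ω i => x i ω
  set H : Ω → Fin 2 × ℕ → ℝ := fun ω p => h p.1 p.2 ω
  have hXm : Measurable X := measurable_pi_lambda _ fun i => hn.points.measurable i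
  have hHm : Measurable H := measurable_pi_lambda _ fun p => hn.measurable_h p.1 p.2
  set K : ℝ≥0∞ × ℝ≥0∞ → ℝ≥0∞ := fun I =>
    ∫⁻ y', ∫⁻ y, ψ I y y' ∂(gammaMeasure mD mD) ∂(gammaMeasure mD mD) with hK
  have hKm : Measurable K := by
    have h1 : Measurable fun p : (ℝ≥0∞ × ℝ≥0∞) × ℝ => ∫⁻ y, ψ p.1 y p.2 ∂(gammaMeasure mD mD) := by
      have : Measurable fun p : ((ℝ≥0∞ × ℝ≥0∞) × ℝ) × ℝ => ψ p.1.1 p.2 p.1.2 :=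
        hψ.comp (by fun_prop : Measurable fun p : ((ℝ≥0∞ × ℝ≥0∞) × ℝ) × ℝ => (p.1.1, p.2, p.1.2))
      exact this.lintegral_prod_right'
    exact h1.lintegral_prod_right'
  have hgh : IndepFun H (fun ω n => g n ω) P :=
    iIndepFun.indepFun_of_disjoint hn.indep_fading hn.measurable_fading
      (u := Sum.inr) (v := Sum.inl) (by simp)
  have hgg : IndepFun (g 1) (g 0) P :=
    hn.indep_fading.indepFun (i := Sum.inl 1) (j := Sum.inl 0) (by simp)
  have hgains : ∀ I, ∫⁻ ω, ψ I (g 0 ω) (g 1 ω) ∂P = K I := by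
    intro I
    rw [lintegral_eq_lintegral_lintegral_of_indepFun hgg (hn.measurable_g 1) (hn.measurable_g 0)
      (F := fun y' y => ψ I y y')
      (hψ.comp (by fun_prop : Measurable fun p : ℝ × ℝ => (I, p.2, p.1)))]
    have h1 : Measurable fun p : ℝ × ℝ => ψ I p.2 p.1 :=
      hψ.comp (by fun_prop : Measurable fun p : ℝ × ℝ => (I, p.2, p.1))
    have h0 : ∀ y', ∫⁻ ω, ψ I (g 0 ω) y' ∂P = ∫⁻ y, ψ I y y' ∂(gammaMeasure mD mD) := by
      intro y'
      rw [← hn.law_g 0]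
      exact (lintegral_map (f := fun y => ψ I y y') (h1.comp measurable_prodMk_left)
        (hn.measurable_g 0)).symm
    simp_rw [h0, hK]
    have h2 := lintegral_map (μ := P) (h1.lintegral_prod_right' (ν := gammaMeasure mD mD))
      (hn.measurable_g 1)
    rw [hn.law_g 1] at h2
    exact h2.symm
  have hinr : Measurable fun p : (ℕ → EuclideanSpace ℝ (Fin 2)) × (Fin 2 ⊕ Fin 2 × ℕ → ℝ) =>
      (p.1, fun q => p.2 (Sum.inr q)) := by fun_prop
  -- Independence of points and fading is used twice: to freeze the points while the desired gains
  -- are replaced by their laws, and then backwards, to reunite the points with the interfering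
  -- gains.
  calc ∫⁻ ω, ψ (J (X ω) (H ω)) (g 0 ω) (g 1 ω) ∂P
      = ∫⁻ ω, ∫⁻ ω', ψ (J (X ω) (H ω')) (g 0 ω') (g 1 ω') ∂P ∂P := by
        refine lintegral_eq_lintegral_lintegral_of_indepFun hn.indep_points
          (F := fun xs fs => ψ (J xs fun p => fs (Sum.inr p)) (fs (Sum.inl 0)) (fs (Sum.inl 1)))
          hXm (measurable_pi_lambda _ fun j => hn.measurable_fading j) ?_
        exact hψ.comp (Measurable.prodMk (hJ.comp hinr) (by fun_prop :
          Measurable fun p : (ℕ → EuclideanSpace ℝ (Fin 2)) × (Fin 2 ⊕ Fin 2 × ℕ → ℝ) =>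
            (p.2 (Sum.inl 0), p.2 (Sum.inl 1))))
    _ = ∫⁻ ω, ∫⁻ ω', K (J (X ω) (H ω')) ∂P ∂P := by
        refine lintegral_congr fun ω => ?_
        refine (lintegral_eq_lintegral_lintegral_of_indepFun hgh hHm
          (measurable_pi_lambda _ fun n => hn.measurable_g n)
          (F := fun hs gs => ψ (J (X ω) hs) (gs 0) (gs 1))
          (hψ.comp (Measurable.prodMk (hJ.comp (by fun_prop :
            Measurable fun p : (Fin 2 × ℕ → ℝ) × (Fin 2 → ℝ) => (X ω, p.1))) (by fun_prop :
            Measurable fun p : (Fin 2 × ℕ → ℝ) × (Fin 2 → ℝ) => (p.2 0, p.2 1))))).trans ?_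
        exact lintegral_congr fun ω' => hgains _
    _ = ∫⁻ ω, K (J (X ω) (H ω)) ∂P := by
        refine (lintegral_eq_lintegral_lintegral_of_indepFun hn.indep_points
          (F := fun xs fs => K (J xs fun p => fs (Sum.inr p)))
          hXm (measurable_pi_lambda _ fun j => hn.measurable_fading j) ?_).symm
        exact hKm.comp (hJ.comp hinr)

end Network

/-! ### Poisson tails and Gamma tails -/

/-- `P(N < m)` for a Poisson variable `N` with mean `y`. -/
noncomputable def poissonTail (m : ℕ) (y : ℝ) : ℝ :=
  ∑ k ∈ Finset.range m, y ^ k / k ! * Real.exp (-y)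

@[fun_prop] theorem continuous_poissonTail (m : ℕ) : Continuous (poissonTail m) := by
  unfold poissonTail
  fun_prop

theorem poissonTail_nonneg (m : ℕ) {y : ℝ} (hy : 0 ≤ y) : 0 ≤ poissonTail m y :=
  Finset.sum_nonneg fun k _ => by positivity

theorem poissonTail_le_one (m : ℕ) {y : ℝ} (hy : 0 ≤ y) : poissonTail m y ≤ 1 := by
  unfold poissonTail
  rw [← Finset.sum_mul, Real.exp_neg, ← div_eq_mul_inv, div_le_one (Real.exp_pos y)]
  exact Real.sum_le_exp_of_nonneg hy m

/-- The derivative telescopes, and only the last term survives. -/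
theorem hasDerivAt_poissonTail_succ (m : ℕ) (y : ℝ) :
    HasDerivAt (poissonTail (m + 1)) (-(y ^ m / m ! * Real.exp (-y))) y := by
  have hexp : HasDerivAt (fun y : ℝ => Real.exp (-y)) (-Real.exp (-y)) y := by
    simpa using (hasDerivAt_neg y).exp
  induction m with
  | zero =>
    have h0 : poissonTail (0 + 1) = fun y => Real.exp (-y) := by
      funext y
      simp [poissonTail]
    rw [h0]
    simpa using hexp
  | succ m ih =>
    have h1 : HasDerivAt (fun y : ℝ => y ^ (m + 1) / (m + 1)! * Real.exp (-y))
        (y ^ m / m ! * Real.exp (-y) - y ^ (m + 1) / (m + 1)! * Real.exp (-y)) y := by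
      refine (((hasDerivAt_pow (m + 1) y).div_const ((m + 1)! : ℝ)).mul hexp).congr_deriv ?_
      rw [Nat.factorial_succ]
      have : (m ! : ℝ) ≠ 0 := by positivity
      push_cast
      field_simp
      ring
    have h2 : poissonTail (m + 1 + 1) =
        fun y => poissonTail (m + 1) y + y ^ (m + 1) / (m + 1)! * Real.exp (-y) := by
      funext y
      exact Finset.sum_range_succ _ _
    rw [h2]
    exact (ih.add h1).congr_deriv (by ring)

theorem tendsto_poissonTail (m : ℕ) : Tendsto (poissonTail m) atTop (𝓝 0) := by
  have : Tendsto (fun y : ℝ => ∑ k ∈ Finset.range m, (k ! : ℝ)⁻¹ * (y ^ k * Real.exp (-y))) atTop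
      (𝓝 (∑ k ∈ Finset.range m, (k ! : ℝ)⁻¹ * 0)) :=
    tendsto_finsetSum _ fun k _ => (Real.tendsto_pow_mul_exp_neg_atTop_nhds_zero k).const_mul _
  simp only [mul_zero, Finset.sum_const_zero] at this
  refine this.congr fun y => Finset.sum_congr rfl fun k _ => ?_
  ring

/-- `-poissonTail (m + 1)` is an antiderivative vanishing at infinity; the sign of the integrand
yields integrability as well. -/
theorem integrableOn_integral_Ioi_pow_mul_exp_neg (m : ℕ) {y : ℝ} (hy : 0 ≤ y) :
    IntegrableOn (fun t : ℝ => t ^ m / m ! * Real.exp (-t)) (Ioi y) ∧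
    ∫ t in Ioi y, t ^ m / m ! * Real.exp (-t) = poissonTail (m + 1) y := by
  have hd : ∀ t ∈ Ici y,
      HasDerivAt (fun t => -poissonTail (m + 1) t) (t ^ m / m ! * Real.exp (-t)) t := by
    intro t _
    exact (hasDerivAt_poissonTail_succ m t).neg.congr_deriv (neg_neg _)
  have hpos : ∀ t ∈ Ioi y, 0 ≤ t ^ m / m ! * Real.exp (-t) := by
    intro t ht
    have : 0 ≤ t := hy.trans (le_of_lt ht)
    positivity
  have hlim : Tendsto (fun t => -poissonTail (m + 1) t) atTop (𝓝 0) := by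
    simpa using (tendsto_poissonTail (m + 1)).neg
  refine ⟨integrableOn_Ioi_deriv_of_nonneg' hd hpos hlim, ?_⟩
  rw [integral_Ioi_of_hasDerivAt_of_nonneg' hd hpos hlim]
  ring

theorem regUpperGamma_natCast (m : ℕ) {y : ℝ} (hy : 0 ≤ y) :
    regUpperGamma ((m + 1 : ℕ) : ℝ) y = poissonTail (m + 1) y := by
  rw [← (integrableOn_integral_Ioi_pow_mul_exp_neg m hy).2, regUpperGamma, upperGamma,
    Nat.cast_succ, Real.Gamma_nat_eq_factorial, ← integral_div]
  refine setIntegral_congr_fun measurableSet_Ioi fun t ht => ?_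
  simp only [add_sub_cancel_right, Real.rpow_natCast]
  ring

/-- The shape matches `integrand`: `m` derivatives in `t` produce the power, and the factor `z⁻¹` is
the one in the formula. -/
theorem gammaPDFReal_natCast {m : ℕ} {r z : ℝ} (hz : 0 < z) :
    gammaPDFReal m r z = z⁻¹ * (r * z) ^ m * Real.exp (-(r * z)) / Real.Gamma m := by
  rw [gammaPDFReal, if_pos hz.le, Real.rpow_natCast, Real.rpow_sub_one hz.ne', Real.rpow_natCast,
    mul_pow]
  ring

theorem integrable_gammaPDFReal {a r : ℝ} (ha : 0 < a) (hr : 0 < r) :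
    Integrable (gammaPDFReal a r) := by
  refine ⟨(stronglyMeasurable_gammaPDFReal a r).aestronglyMeasurable, ?_⟩
  rw [hasFiniteIntegral_iff_ofReal (ae_of_all _ fun z => gammaPDFReal_nonneg ha hr z)]
  have := lintegral_gammaPDF_eq_one ha hr
  simp only [gammaPDF] at this
  rw [this]
  simp

theorem integral_gammaMeasure {a r : ℝ} (ha : 0 < a) (hr : 0 < r) (f : ℝ → ℝ) :
    ∫ y, f y ∂(gammaMeasure a r) = ∫ z in Ioi (0 : ℝ), gammaPDFReal a r z * f z := by
  rw [gammaMeasure, integral_withDensity_eq_integral_toReal_smul (measurable_gammaPDF a r)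
    (ae_of_all _ fun z => by simp [gammaPDF])]
  simp only [gammaPDF, ENNReal.toReal_ofReal (gammaPDFReal_nonneg ha hr _), smul_eq_mul]
  rw [← integral_Ici_eq_integral_Ioi, setIntegral_eq_integral_of_forall_compl_eq_zero]
  intro z hz
  rw [gammaPDFReal, if_neg (by simpa using hz), zero_mul]

/-- Tail of the Gamma law with integer shape `m` and rate `m`. -/
theorem gammaMeasure_Ici {m : ℕ} (hm : 0 < m) {y : ℝ} (hy : 0 ≤ y) :
    gammaMeasure m m (Ici y) = ENNReal.ofReal (poissonTail m (m * y)) := by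
  have hm' : (0 : ℝ) < m := by exact_mod_cast hm
  have := isProbabilityMeasure_gammaMeasure hm' hm'
  obtain ⟨n, rfl⟩ := Nat.exists_eq_add_one_of_ne_zero hm.ne'
  have hmy : 0 ≤ ((n + 1 : ℕ) : ℝ) * y := by positivity
  rw [← (integrableOn_integral_Ioi_pow_mul_exp_neg n hmy).2, ← ofReal_measureReal]
  congr 1
  rw [← integral_indicator_one measurableSet_Ici, integral_gammaMeasure hm' hm']
  have h1 := integral_comp_mul_left_Ioi
    (fun t : ℝ => t ^ n / n ! * Real.exp (-t)) y hm'
  rw [eq_inv_smul_iff₀ hm'.ne', smul_eq_mul] at h1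
  rw [← h1, ← integral_const_mul, ← integral_Ici_eq_integral_Ioi, ← integral_Ici_eq_integral_Ioi,
    ← integral_indicator measurableSet_Ici, ← integral_indicator measurableSet_Ici]
  refine integral_congr_ae ?_
  filter_upwards [Measure.ae_ne volume (0 : ℝ)] with z hz
  by_cases h : y ≤ z
  · have hz0 : 0 < z := (hy.trans h).lt_of_ne' hz
    rw [indicator_of_mem (by exact hz0.le), indicator_of_mem (by exact h),
      indicator_of_mem (by exact h), gammaPDFReal_natCast hz0, Nat.cast_succ,
      Real.Gamma_nat_eq_factorial]
    simp only [Pi.one_apply]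
    field_simp
    ring
  · rw [indicator_of_notMem (s := Ici y) (by exact h)]
    simp [indicator, h]

/-! ### The success probability for given interference -/

/-- Success probability for interference-plus-noise powers `w₁`, `w₂`. -/
noncomputable def condSuccess (m : ℕ) (T w₁ w₂ : ℝ) : ℝ :=
  ∫ y, poissonTail m (m * w₁ * max 0 (T - y / w₂)) ∂(gammaMeasure m m)

theorem poissonTail_arg_nonneg (m : ℕ) (T : ℝ) {w₁ : ℝ} (hw₁ : 0 ≤ w₁) (u : ℝ) :
    0 ≤ m * w₁ * max 0 (T - u) := by positivity

theorem condSuccess_nonneg (m : ℕ) (T : ℝ) {w₁ : ℝ} (hw₁ : 0 ≤ w₁) (w₂ : ℝ) :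
    0 ≤ condSuccess m T w₁ w₂ :=
  integral_nonneg fun _ => poissonTail_nonneg m (poissonTail_arg_nonneg m T hw₁ _)

theorem integrable_condSuccess_integrand {m : ℕ} (hm : 0 < m) (T : ℝ) {w₁ : ℝ} (hw₁ : 0 ≤ w₁)
    (w₂ : ℝ) :
    Integrable (fun y => poissonTail m (m * w₁ * max 0 (T - y / w₂))) (gammaMeasure m m) := by
  have hm' : (0 : ℝ) < m := by exact_mod_cast hm
  have := isProbabilityMeasure_gammaMeasure hm' hm'
  refine Integrable.of_bound (C := 1) (by fun_prop) (ae_of_all _ fun y => ?_)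
  have h0 := poissonTail_arg_nonneg m T hw₁ (y / w₂)
  rw [Real.norm_of_nonneg (poissonTail_nonneg m h0)]
  exact poissonTail_le_one m h0

theorem condSuccess_le_one {m : ℕ} (hm : 0 < m) (T : ℝ) {w₁ : ℝ} (hw₁ : 0 ≤ w₁) (w₂ : ℝ) :
    condSuccess m T w₁ w₂ ≤ 1 := by
  have hm' : (0 : ℝ) < m := by exact_mod_cast hm
  have := isProbabilityMeasure_gammaMeasure hm' hm'
  have := integral_mono (integrable_condSuccess_integrand hm T hw₁ w₂) (integrable_const (1 : ℝ))
    fun y => poissonTail_le_one m (poissonTail_arg_nonneg m T hw₁ (y / w₂))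
  simpa [condSuccess] using this

/-- Dominated convergence with bound 1. Only the limit `w₂` must be positive, so that the quotient
`y / w₂` is continuous there. -/
theorem tendsto_condSuccess {ι : Type*} {l : Filter ι} [l.IsCountablyGenerated] {m : ℕ}
    (hm : 0 < m) (T : ℝ) {u₁ u₂ : ι → ℝ} {w₁ w₂ : ℝ} (h₁ : Tendsto u₁ l (𝓝 w₁))
    (h₂ : Tendsto u₂ l (𝓝 w₂)) (hu₁ : ∀ᶠ i in l, 0 ≤ u₁ i) (hw₂ : 0 < w₂) :
    Tendsto (fun i => condSuccess m T (u₁ i) (u₂ i)) l (𝓝 (condSuccess m T w₁ w₂)) := by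
  have hm' : (0 : ℝ) < m := by exact_mod_cast hm
  have := isProbabilityMeasure_gammaMeasure hm' hm'
  refine tendsto_integral_filter_of_dominated_convergence (fun _ => 1)
    (Eventually.of_forall fun i => by fun_prop)
    (hu₁.mono fun i hi => ae_of_all _ fun y => ?_) (integrable_const _)
    (ae_of_all _ fun y => ?_)
  · have h0 := poissonTail_arg_nonneg m T hi (y / u₂ i)
    rw [Real.norm_of_nonneg (poissonTail_nonneg m h0)]
    exact poissonTail_le_one m h0
  · refine ((continuous_poissonTail m).tendsto _).comp ((h₁.const_mul _).mul ?_)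
    exact tendsto_const_nhds.max (tendsto_const_nhds.sub (tendsto_const_nhds.div h₂ hw₂.ne'))

theorem measurable_condSuccess (m : ℕ) (T : ℝ) :
    Measurable fun p : ℝ × ℝ => condSuccess m T p.1 p.2 := by
  have hs : SFinite (gammaMeasure m m) := by unfold gammaMeasure; infer_instance
  have : Measurable fun p : (ℝ × ℝ) × ℝ => poissonTail m (m * p.1.1 * max 0 (T - p.2 / p.1.2)) :=
    (continuous_poissonTail m).measurable.comp (by fun_prop)
  exact (this.stronglyMeasurable.integral_prod_right' (ν := gammaMeasure m m)).measurable

/-- Substituting `y = w₂ z` makes `z`, the SINR of the second branch, the integration variable, as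
in `formula`. -/
theorem condSuccess_eq_setIntegral {m : ℕ} (hm : 0 < m) (T w₁ : ℝ) {w₂ : ℝ} (hw₂ : 0 < w₂) :
    condSuccess m T w₁ w₂ = ∫ z in Ioi (0 : ℝ),
      gammaPDFReal m (m * w₂) z * poissonTail m (m * w₁ * max 0 (T - z)) := by
  have hm' : (0 : ℝ) < m := by exact_mod_cast hm
  rw [condSuccess, integral_gammaMeasure hm' hm']
  have h1 := integral_comp_mul_left_Ioi (fun y : ℝ =>
    gammaPDFReal m m y * poissonTail m (m * w₁ * max 0 (T - y / w₂))) 0 hw₂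
  rw [mul_zero, eq_inv_smul_iff₀ hw₂.ne', smul_eq_mul] at h1
  rw [← h1, ← integral_const_mul]
  refine setIntegral_congr_fun measurableSet_Ioi fun z hz => ?_
  have hz : 0 < z := hz
  rw [gammaPDFReal_natCast hz, gammaPDFReal_natCast (mul_pos hw₂ hz),
    mul_div_cancel_left₀ _ hw₂.ne', ← mul_assoc (m : ℝ) w₂ z]
  field_simp

/-! ### Derivatives of Laplace transforms -/

section Laplace

variable {Ω : Type*} [MeasurableSpace Ω] {P : Measure Ω}

/-- With the weight `ρ` absorbed into the measure this is the moment generating function of `-Y`,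
which is analytic inside its domain of integrability; `Y ≥ 0` puts `(0, ∞)` there. -/
theorem laplace_contDiffAt_iteratedDeriv {ρ Y : Ω → ℝ} (hρm : Measurable ρ) (hρ0 : ∀ ω, 0 ≤ ρ ω)
    (hρ : Integrable ρ P) (hYm : Measurable Y) (hY0 : ∀ ω, 0 ≤ Y ω) {t : ℝ} (ht : 0 < t) (n : ℕ) :
    ContDiffAt ℝ n (fun t => ∫ ω, ρ ω * Real.exp (-(t * Y ω)) ∂P) t ∧
    iteratedDeriv n (fun t => ∫ ω, ρ ω * Real.exp (-(t * Y ω)) ∂P) t =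
      (-1) ^ n * ∫ ω, ρ ω * (Y ω ^ n * Real.exp (-(t * Y ω))) ∂P := by
  set μ : Measure Ω := P.withDensity fun ω => ENNReal.ofReal (ρ ω)
  have hρe : Measurable fun ω => ENNReal.ofReal (ρ ω) := hρm.ennreal_ofReal
  have hint : ∀ f : Ω → ℝ, ∫ ω, f ω ∂μ = ∫ ω, ρ ω * f ω ∂P := by
    intro f
    rw [integral_withDensity_eq_integral_toReal_smul hρe (ae_of_all _ fun ω => by simp)]
    simp only [ENNReal.toReal_ofReal (hρ0 _), smul_eq_mul]
  have hF : (fun t => ∫ ω, ρ ω * Real.exp (-(t * Y ω)) ∂P) = mgf (fun ω => -Y ω) μ := by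
    funext t
    rw [mgf, hint]
    simp only [mul_neg]
  have hset : Ioi (0 : ℝ) ⊆ integrableExpSet (fun ω => -Y ω) μ := by
    intro s hs
    have hs : 0 < s := hs
    rw [integrableExpSet, mem_ofPred_eq, integrable_withDensity_iff_integrable_smul' hρe
      (ae_of_all _ fun ω => by simp)]
    simp only [ENNReal.toReal_ofReal (hρ0 _), smul_eq_mul]
    refine hρ.mono' (by fun_prop) (ae_of_all _ fun ω => ?_)
    rw [norm_mul, Real.norm_of_nonneg (hρ0 ω), Real.norm_of_nonneg (Real.exp_pos _).le]
    refine mul_le_of_le_one_right (hρ0 ω) (Real.exp_le_one_iff.2 ?_)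
    nlinarith [hY0 ω]
  have hmem : t ∈ interior (integrableExpSet (fun ω => -Y ω) μ) :=
    interior_maximal hset isOpen_Ioi ht
  rw [hF]
  refine ⟨(analyticAt_mgf hmem).contDiffAt, ?_⟩
  rw [iteratedDeriv_mgf hmem, hint, ← integral_const_mul]
  refine integral_congr_ae (ae_of_all _ fun ω => ?_)
  simp only [mul_neg]
  rw [neg_pow]
  ring

theorem pow_mul_exp_neg_le_factorial (k : ℕ) {y : ℝ} (hy : 0 ≤ y) :
    y ^ k * Real.exp (-y) ≤ k ! := by
  rw [Real.exp_neg, ← div_eq_mul_inv, div_le_iff₀ (Real.exp_pos y), mul_comm,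
    ← div_le_iff₀ (by positivity)]
  exact Real.pow_div_factorial_le_exp y hy k

/-- The integrand after differentiation under the expectation, for given interference. -/
noncomputable def condIntegrand (m k : ℕ) (T z w₁ w₂ : ℝ) : ℝ :=
  z⁻¹ * ((m * max 0 (T - z) * w₁) ^ k * Real.exp (-(m * max 0 (T - z) * w₁)) *
    ((m * z * w₂) ^ m * Real.exp (-(m * z * w₂))))

theorem condIntegrand_nonneg (m k : ℕ) (T : ℝ) {z w₁ w₂ : ℝ} (hz : 0 < z) (hw₁ : 0 ≤ w₁)
    (hw₂ : 0 ≤ w₂) : 0 ≤ condIntegrand m k T z w₁ w₂ := by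
  unfold condIntegrand
  positivity

theorem condIntegrand_eq_gammaPDFReal {m : ℕ} (hm : 0 < m) (k : ℕ) (T w₁ : ℝ) {z w₂ : ℝ}
    (hz : 0 < z) :
    condIntegrand m k T z w₁ w₂ = Real.Gamma m * (gammaPDFReal m (m * w₂) z *
      ((m * w₁ * max 0 (T - z)) ^ k * Real.exp (-(m * w₁ * max 0 (T - z))))) := by
  have hΓ := (Real.Gamma_pos_of_pos (show (0 : ℝ) < m by exact_mod_cast hm)).ne'
  rw [condIntegrand, gammaPDFReal_natCast hz, show m * z * w₂ = m * w₂ * z by ring,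
    mul_right_comm (m : ℝ) (max 0 (T - z)) w₁]
  field_simp

/-- The `k`-dependent factor is at most `k!`, and the rest is `Γ(m)` times a probability density.
The bound is uniform in `w₁`, `w₂`, so Fubini needs no moment of the interference. -/
theorem lintegral_condIntegrand_le {m : ℕ} (hm : 0 < m) (k : ℕ) (T : ℝ) {w₁ w₂ : ℝ}
    (hw₁ : 0 ≤ w₁) (hw₂ : 0 ≤ w₂) :
    ∫⁻ z in Ioi (0 : ℝ), ENNReal.ofReal (condIntegrand m k T z w₁ w₂) ≤
      ENNReal.ofReal (Real.Gamma m * k !) := by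
  have hm' : (0 : ℝ) < m := by exact_mod_cast hm
  have hΓ := Real.Gamma_pos_of_pos hm'
  rcases hw₂.eq_or_lt with rfl | hw₂
  -- At `w₂ = 0` there is no density, but the factor `(m z w₂)^m` vanishes since `m > 0`.
  · simp [condIntegrand, hm.ne']
  · calc ∫⁻ z in Ioi (0 : ℝ), ENNReal.ofReal (condIntegrand m k T z w₁ w₂)
        ≤ ∫⁻ z in Ioi (0 : ℝ), ENNReal.ofReal (Real.Gamma m * k !) * gammaPDF m (m * w₂) z := by
          refine setLIntegral_mono' measurableSet_Ioi fun z hz => ?_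
          rw [gammaPDF, ← ENNReal.ofReal_mul (by positivity),
            condIntegrand_eq_gammaPDFReal hm _ _ _ hz]
          refine ENNReal.ofReal_le_ofReal ?_
          have h1 := gammaPDFReal_nonneg hm' (mul_pos hm' hw₂) z
          have h2 := pow_mul_exp_neg_le_factorial k (poissonTail_arg_nonneg m T hw₁ z)
          calc _ ≤ Real.Gamma m * (gammaPDFReal m (m * w₂) z * k !) := by gcongr
            _ = _ := by ring
      _ ≤ ∫⁻ z, ENNReal.ofReal (Real.Gamma m * k !) * gammaPDF m (m * w₂) z :=
          setLIntegral_le_lintegral _ _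
      _ = ENNReal.ofReal (Real.Gamma m * k !) := by
          rw [lintegral_const_mul' _ _ ENNReal.ofReal_ne_top,
            lintegral_gammaPDF_eq_one hm' (mul_pos hm' hw₂), mul_one]

theorem integrable_prod_condIntegrand [IsFiniteMeasure P] {m : ℕ} (hm : 0 < m) (k : ℕ) (T : ℝ)
    {W₁ W₂ : Ω → ℝ} (h₁ : Measurable W₁) (h₂ : Measurable W₂) (h₁0 : ∀ ω, 0 ≤ W₁ ω)
    (h₂0 : ∀ ω, 0 ≤ W₂ ω) :
    Integrable (fun p : ℝ × Ω => condIntegrand m k T p.1 (W₁ p.2) (W₂ p.2))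
      ((volume.restrict (Ioi 0)).prod P) := by
  have hmeas : Measurable fun p : ℝ × Ω => condIntegrand m k T p.1 (W₁ p.2) (W₂ p.2) := by
    unfold condIntegrand
    fun_prop
  refine ⟨hmeas.aestronglyMeasurable, ?_⟩
  rw [hasFiniteIntegral_iff_enorm, lintegral_prod_symm _ hmeas.enorm.aemeasurable]
  refine lt_of_le_of_lt (lintegral_mono (g := fun _ => ENNReal.ofReal (Real.Gamma m * k !))
    fun ω => ?_) ?_
  · refine le_trans (le_of_eq ?_) (lintegral_condIntegrand_le hm k T (h₁0 ω) (h₂0 ω))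
    refine setLIntegral_congr_fun measurableSet_Ioi fun z hz => ?_
    exact Real.enorm_of_nonneg (condIntegrand_nonneg m k T hz (h₁0 ω) (h₂0 ω))
  · rw [lintegral_const]
    exact ENNReal.mul_lt_top ENNReal.ofReal_lt_top (measure_lt_top _ _)

/-- Summing over `k` rebuilds the Poisson tail against the density of `g₂ / w₂`. At `w₂ = 0` the
left side is zero, whence the strict positivity. -/
theorem sum_setIntegral_condIntegrand {m : ℕ} (hm : 0 < m) (T : ℝ) {w₁ w₂ : ℝ} (hw₁ : 0 ≤ w₁)
    (hw₂ : 0 < w₂) :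
    ∑ k ∈ Finset.range m, (k ! * Real.Gamma m)⁻¹ * ∫ z in Ioi (0 : ℝ), condIntegrand m k T z w₁ w₂ =
      condSuccess m T w₁ w₂ := by
  have hm' : (0 : ℝ) < m := by exact_mod_cast hm
  have hΓ := (Real.Gamma_pos_of_pos hm').ne'
  rw [condSuccess_eq_setIntegral hm T w₁ hw₂]
  simp_rw [← integral_const_mul]
  rw [← integral_finsetSum]
  · refine setIntegral_congr_fun measurableSet_Ioi fun z hz => ?_
    simp only [poissonTail, Finset.mul_sum]
    refine Finset.sum_congr rfl fun k _ => ?_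
    rw [condIntegrand_eq_gammaPDFReal hm _ _ _ hz]
    have : (k ! : ℝ) ≠ 0 := by positivity
    field_simp
  · intro k _
    have hmeas : Measurable fun z : ℝ => condIntegrand m k T z w₁ w₂ := by
      unfold condIntegrand
      fun_prop
    refine Integrable.const_mul ⟨hmeas.aestronglyMeasurable, ?_⟩ _
    rw [hasFiniteIntegral_iff_ofReal]
    · exact (lintegral_condIntegrand_le hm k T hw₁ hw₂.le).trans_lt ENNReal.ofReal_lt_top
    · filter_upwards [ae_restrict_mem measurableSet_Ioi] with z hz
      exact condIntegrand_nonneg m k T hz hw₁ hw₂.le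

/-! ### The integral formula as an expectation -/

/-- The exponential in the formula is the joint Laplace transform of `W₁`, `W₂`. -/
def BracketIsLaplace (P : Measure Ω) (α d lam : ℝ) (mD : ℕ) (mI T ν : ℝ) (W₁ W₂ : Ω → ℝ) : Prop :=
  ∀ z s t : ℝ, 0 < z → 0 < s → 0 < t → bracket α d lam mD mI T ν z s t =
    ∫ ω, Real.exp (-(s * (mD * max 0 (T - z) * W₁ ω))) * Real.exp (-(t * (mD * z * W₂ ω))) ∂P

variable {α d lam mI T ν : ℝ} {mD : ℕ} {W₁ W₂ : Ω → ℝ}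

theorem BracketIsLaplace.contDiffAt_iteratedDeriv_left [IsProbabilityMeasure P]
    (hB : BracketIsLaplace P α d lam mD mI T ν W₁ W₂) (h₁ : Measurable W₁) (h₂ : Measurable W₂)
    (h₁0 : ∀ ω, 0 ≤ W₁ ω) (h₂0 : ∀ ω, 0 ≤ W₂ ω) {z s : ℝ} (hz : 0 < z) (hs : 0 < s) :
    ContDiffAt ℝ mD (fun t => bracket α d lam mD mI T ν z s t) 1 ∧
    iteratedDeriv mD (fun t => bracket α d lam mD mI T ν z s t) 1 =
      (-1) ^ mD * ∫ ω, (mD * z * W₂ ω) ^ mD * Real.exp (-(mD * z * W₂ ω)) *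
        Real.exp (-(s * (mD * max 0 (T - z) * W₁ ω))) ∂P := by
  have hX0 : ∀ ω, 0 ≤ s * (mD * max 0 (T - z) * W₁ ω) := fun ω => by
    have := h₁0 ω
    positivity
  have key := laplace_contDiffAt_iteratedDeriv (P := P)
    (ρ := fun ω => Real.exp (-(s * (mD * max 0 (T - z) * W₁ ω)))) (Y := fun ω => mD * z * W₂ ω)
    (by fun_prop) (fun ω => (Real.exp_pos _).le)
    (Integrable.of_bound (C := 1) (by fun_prop) (ae_of_all _ fun ω => by
      rw [Real.norm_of_nonneg (Real.exp_pos _).le]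
      exact Real.exp_le_one_iff.2 (neg_nonpos.2 (hX0 ω))))
    (by fun_prop) (fun ω => by have := h₂0 ω; positivity) one_pos mD
  -- The Laplace representation holds for positive arguments only; a neighbourhood of 1 suffices for
  -- derivatives.
  have heq : (fun t => bracket α d lam mD mI T ν z s t) =ᶠ[𝓝 1] fun t =>
      ∫ ω, Real.exp (-(s * (mD * max 0 (T - z) * W₁ ω))) * Real.exp (-(t * (mD * z * W₂ ω))) ∂P := by
    filter_upwards [Ioi_mem_nhds one_pos] with t ht using hB z s t hz hs ht
  refine ⟨key.1.congr_of_eventuallyEq heq, ?_⟩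
  rw [heq.iteratedDeriv_eq, key.2]
  congr 1
  refine integral_congr_ae (ae_of_all _ fun ω => ?_)
  simp only [one_mul]
  ring

/-- After the `t`-derivatives a Laplace transform in `s` remains, whose weight `(m z W₂)^m e^(-m z
W₂)` is bounded by `m!`, so the differentiation lemma applies a second time. -/
theorem BracketIsLaplace.contDiffAt_iteratedDeriv_right [IsProbabilityMeasure P]
    (hB : BracketIsLaplace P α d lam mD mI T ν W₁ W₂) (h₁ : Measurable W₁) (h₂ : Measurable W₂)
    (h₁0 : ∀ ω, 0 ≤ W₁ ω) (h₂0 : ∀ ω, 0 ≤ W₂ ω) {z : ℝ} (hz : 0 < z) (k : ℕ) :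
    ContDiffAt ℝ k
      (fun s => iteratedDeriv mD (fun t => bracket α d lam mD mI T ν z s t) 1) 1 ∧
    integrand α d lam mD mI T ν k z =
      (-1) ^ (k + mD) * ∫ ω, condIntegrand mD k T z (W₁ ω) (W₂ ω) ∂P := by
  have hY0 : ∀ ω, 0 ≤ mD * z * W₂ ω := fun ω => by
    have := h₂0 ω
    positivity
  have hρ0 : ∀ ω, 0 ≤ (mD * z * W₂ ω) ^ mD * Real.exp (-(mD * z * W₂ ω)) := fun ω => by
    have := hY0 ω
    positivity
  have key := laplace_contDiffAt_iteratedDeriv (P := P)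
    (ρ := fun ω => (mD * z * W₂ ω) ^ mD * Real.exp (-(mD * z * W₂ ω)))
    (Y := fun ω => mD * max 0 (T - z) * W₁ ω) (by fun_prop) hρ0
    (Integrable.of_bound (C := (mD ! : ℝ)) (by fun_prop) (ae_of_all _ fun ω => by
      rw [Real.norm_of_nonneg (hρ0 ω)]
      exact pow_mul_exp_neg_le_factorial mD (hY0 ω)))
    (by fun_prop) (fun ω => by have := h₁0 ω; positivity) one_pos k
  have heq : (fun s => iteratedDeriv mD (fun t => bracket α d lam mD mI T ν z s t) 1) =ᶠ[𝓝 1]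
      fun s => (-1) ^ mD * ∫ ω, (mD * z * W₂ ω) ^ mD * Real.exp (-(mD * z * W₂ ω)) *
        Real.exp (-(s * (mD * max 0 (T - z) * W₁ ω))) ∂P := by
    filter_upwards [Ioi_mem_nhds one_pos] with s hs
    exact (hB.contDiffAt_iteratedDeriv_left h₁ h₂ h₁0 h₂0 hz hs).2
  refine ⟨(contDiffAt_const.mul key.1).congr_of_eventuallyEq heq, ?_⟩
  rw [integrand, heq.iteratedDeriv_eq, iteratedDeriv_const_mul_field, key.2]
  simp only [condIntegrand]
  rw [integral_const_mul, pow_add]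
  simp only [one_mul]
  have : ∀ ω, (mD * z * W₂ ω) ^ mD * Real.exp (-(mD * z * W₂ ω)) *
      ((mD * max 0 (T - z) * W₁ ω) ^ k * Real.exp (-(mD * max 0 (T - z) * W₁ ω))) =
      (mD * max 0 (T - z) * W₁ ω) ^ k * Real.exp (-(mD * max 0 (T - z) * W₁ ω)) *
      ((mD * z * W₂ ω) ^ mD * Real.exp (-(mD * z * W₂ ω))) := fun ω => by ring
  simp_rw [this]
  ring

theorem BracketIsLaplace.formulaMeaningful [IsProbabilityMeasure P] (hmD : 0 < mD)
    (hB : BracketIsLaplace P α d lam mD mI T ν W₁ W₂) (h₁ : Measurable W₁) (h₂ : Measurable W₂)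
    (h₁0 : ∀ ω, 0 ≤ W₁ ω) (h₂0 : ∀ ω, 0 ≤ W₂ ω) :
    FormulaMeaningful α d lam mD mI T ν := by
  refine ⟨fun z hz => ⟨?_, (hB.contDiffAt_iteratedDeriv_right h₁ h₂ h₁0 h₂0 hz mD).1⟩,
    fun k _ => ?_⟩
  · filter_upwards [Ioi_mem_nhds one_pos] with s hs
    exact (hB.contDiffAt_iteratedDeriv_left h₁ h₂ h₁0 h₂0 hz hs).1
  · refine IntegrableOn.congr_fun ?_ (fun z hz =>
      (hB.contDiffAt_iteratedDeriv_right h₁ h₂ h₁0 h₂0 hz k).2.symm) measurableSet_Ioi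
    exact ((integrable_prod_condIntegrand hmD k T h₁ h₂ h₁0 h₂0).integral_prod_left).const_mul _

/-- The sign from differentiation cancels the sign in `formula`; Fubini and the pointwise summation
over `k` do the rest. -/
theorem BracketIsLaplace.formula_eq [IsProbabilityMeasure P] (hmD : 0 < mD)
    (hB : BracketIsLaplace P α d lam mD mI T ν W₁ W₂) (h₁ : Measurable W₁) (h₂ : Measurable W₂)
    (h₁0 : ∀ ω, 0 ≤ W₁ ω) (h₂0 : ∀ ω, 0 ≤ W₂ ω) (hpos : ∀ᵐ ω ∂P, 0 < W₂ ω) :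
    formula α d lam mD mI T ν = ∫ ω, condSuccess mD T (W₁ ω) (W₂ ω) ∂P := by
  have hint := fun k => integrable_prod_condIntegrand (P := P) hmD k T h₁ h₂ h₁0 h₂0
  have hterm : ∀ k, (-1) ^ (k + mD) / (k ! * Real.Gamma mD) *
      ∫ z in Ioi (0 : ℝ), integrand α d lam mD mI T ν k z =
      ∫ ω, (k ! * Real.Gamma mD)⁻¹ *
        (∫ z in Ioi (0 : ℝ), condIntegrand mD k T z (W₁ ω) (W₂ ω)) ∂P := by
    intro k
    rw [setIntegral_congr_fun measurableSet_Ioi fun z hz =>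
      (hB.contDiffAt_iteratedDeriv_right h₁ h₂ h₁0 h₂0 hz k).2, integral_const_mul,
      integral_const_mul, integral_integral_swap (hint k), ← mul_assoc, div_mul_eq_mul_div,
      ← pow_add, Even.neg_one_pow ⟨k + mD, rfl⟩, one_div]
  unfold formula
  rw [Finset.sum_congr rfl fun k _ => hterm k, ← integral_finsetSum]
  · refine integral_congr_ae ?_
    filter_upwards [hpos] with ω hω
    exact sum_setIntegral_condIntegrand hmD T (h₁0 ω) hω
  · exact fun k _ => ((hint k).integral_prod_right).const_mul _

end Laplace

/-! ### Equal interference powers -/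

theorem integral_pow_mul_sub_pow (n k : ℕ) {T : ℝ} (hT : 0 < T) :
    ∫ z in (0 : ℝ)..T, z ^ n * (T - z) ^ k =
      T ^ (n + 1 + k) * (n ! * k ! / (n + 1 + k)!) := by
  have h := intervalIntegral.integral_comp_mul_left (a := 0) (b := 1)
    (fun z : ℝ => z ^ n * (T - z) ^ k) hT.ne'
  rw [mul_zero, mul_one, eq_inv_smul_iff₀ hT.ne', smul_eq_mul] at h
  have hbeta := (integral_beta (p := n + 1) (q := k + 1) (by positivity) (by positivity)).2
  rw [Real.Gamma_nat_eq_factorial, Real.Gamma_nat_eq_factorial,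
    show (n : ℝ) + 1 + (k + 1) = ((n + 1 + k : ℕ) : ℝ) + 1 by push_cast; ring,
    Real.Gamma_nat_eq_factorial] at hbeta
  simp only [add_sub_cancel_right, Real.rpow_natCast] at hbeta
  rw [← h, ← hbeta, ← intervalIntegral.integral_const_mul, ← intervalIntegral.integral_const_mul]
  refine intervalIntegral.integral_congr fun u _ => ?_
  rw [show T - T * u = T * (1 - u) by ring, mul_pow, mul_pow]
  ring

theorem setIntegral_gammaPDFReal_Ioi {m : ℕ} (hm : 0 < m) {r T : ℝ} (hr : 0 < r) (hT : 0 ≤ T) :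
    ∫ z in Ioi T, gammaPDFReal m r z = poissonTail m (r * T) := by
  obtain ⟨n, rfl⟩ := Nat.exists_eq_add_one_of_ne_zero hm.ne'
  have h1 := integral_comp_mul_left_Ioi (fun t : ℝ => t ^ n / n ! * Real.exp (-t)) T hr
  rw [(integrableOn_integral_Ioi_pow_mul_exp_neg n (by positivity)).2, eq_inv_smul_iff₀ hr.ne',
    smul_eq_mul] at h1
  rw [← h1, ← integral_const_mul]
  refine setIntegral_congr_fun measurableSet_Ioi fun z hz => ?_
  have hz : 0 < z := hT.trans_lt hz
  rw [gammaPDFReal_natCast hz, Nat.cast_succ, Real.Gamma_nat_eq_factorial]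
  field_simp
  ring

/-- For equal powers the event concerns `g₁ + g₂`, of shape `2m`. Splitting at `z = T`, the part
above gives the Poisson terms of index below `m`. Below `T` the exponentials merge into `e^(-r T)`,
and Beta integrals give the terms of index `m + k`. -/
theorem condSuccess_self {m : ℕ} (hm : 0 < m) {T w : ℝ} (hT : 0 < T) (hw : 0 < w) :
    condSuccess m T w w = poissonTail (2 * m) (m * w * T) := by
  have hm' : (0 : ℝ) < m := by exact_mod_cast hm
  obtain ⟨r, hrw⟩ : ∃ r : ℝ, r = m * w := ⟨_, rfl⟩
  have hr : 0 < r := hrw ▸ mul_pos hm' hw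
  have hpdf := integrable_gammaPDFReal hm' hr
  rw [condSuccess_eq_setIntegral hm T w hw, ← hrw]
  have hint : Integrable fun z => gammaPDFReal m r z * poissonTail m (r * max 0 (T - z)) := by
    refine hpdf.mul_bdd (c := 1) (by fun_prop) (ae_of_all _ fun z => ?_)
    have h0 : 0 ≤ r * max 0 (T - z) := by positivity
    rw [Real.norm_of_nonneg (poissonTail_nonneg m h0)]
    exact poissonTail_le_one m h0
  rw [← Ioc_union_Ioi_eq_Ioi hT.le, setIntegral_union Ioc_disjoint_Ioi_same measurableSet_Ioi
    hint.integrableOn hint.integrableOn]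
  have h2 : ∫ z in Ioi T, gammaPDFReal m r z * poissonTail m (r * max 0 (T - z)) =
      poissonTail m (r * T) := by
    rw [← setIntegral_gammaPDFReal_Ioi hm hr hT.le]
    refine setIntegral_congr_fun measurableSet_Ioi fun z hz => ?_
    have h0 : max 0 (T - z) = 0 := max_eq_left (sub_nonpos.2 (le_of_lt hz))
    have h1 : poissonTail m 0 = 1 := by
      obtain ⟨n, rfl⟩ := Nat.exists_eq_add_one_of_ne_zero hm.ne'
      simp [poissonTail, Finset.sum_range_succ']
    simp only [h0, mul_zero, h1, mul_one]
  have h1 : ∫ z in Ioc 0 T, gammaPDFReal m r z * poissonTail m (r * max 0 (T - z)) =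
      ∑ k ∈ Finset.range m, (r * T) ^ (m + k) / (m + k)! * Real.exp (-(r * T)) := by
    obtain ⟨n, rfl⟩ := Nat.exists_eq_add_one_of_ne_zero hm.ne'
    have hpt : ∀ z ∈ Ioc 0 T, gammaPDFReal (n + 1 : ℕ) r z *
        poissonTail (n + 1) (r * max 0 (T - z)) =
        ∑ k ∈ Finset.range (n + 1), r ^ (n + 1 + k) / (n ! * k !) * Real.exp (-(r * T)) *
          (z ^ n * (T - z) ^ k) := by
      intro z hz
      have he : Real.exp (-(r * T)) = Real.exp (-(r * z)) * Real.exp (-(r * (T - z))) := by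
        rw [← Real.exp_add]
        ring_nf
      rw [max_eq_right (sub_nonneg.2 hz.2), gammaPDFReal_natCast hz.1, Nat.cast_succ,
        Real.Gamma_nat_eq_factorial, poissonTail, Finset.mul_sum, he]
      refine Finset.sum_congr rfl fun k _ => ?_
      have := hz.1.ne'
      rw [mul_pow, mul_pow, pow_succ z n, pow_add]
      field_simp
      ring
    rw [setIntegral_congr_fun measurableSet_Ioc hpt, ← intervalIntegral.integral_of_le hT.le,
      intervalIntegral.integral_finsetSum fun k _ =>
        Continuous.intervalIntegrable (by fun_prop) _ _]
    refine Finset.sum_congr rfl fun k _ => ?_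
    rw [intervalIntegral.integral_const_mul, integral_pow_mul_sub_pow n k hT, mul_pow]
    have h3 : (n ! : ℝ) ≠ 0 := by positivity
    have h4 : (k ! : ℝ) ≠ 0 := by positivity
    field_simp
  rw [h1, h2, two_mul, poissonTail, poissonTail, Finset.sum_range_add, add_comm]

theorem condSuccess_self_eq_regUpperGamma {m : ℕ} (hm : 0 < m) {T w : ℝ} (hT : 0 < T)
    (hw : 0 < w) : condSuccess m T w w = regUpperGamma (2 * m) (m * T * w) := by
  obtain ⟨n, hn⟩ := Nat.exists_eq_add_one_of_ne_zero (show 2 * m ≠ 0 by omega)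
  have h2 : (2 * m : ℝ) = ((n + 1 : ℕ) : ℝ) := by rw [← hn]; push_cast; ring
  rw [condSuccess_self hm hT hw, h2, regUpperGamma_natCast n (by positivity), hn,
    mul_right_comm (m : ℝ)]

/-- At density zero the bracket is the Laplace transform of two constants, so a one-point space
brings `F(0, ν)` under the general results without any network. -/
theorem bracketIsLaplace_zero (α d : ℝ) (mD : ℕ) (mI T ν : ℝ) :
    BracketIsLaplace (Measure.dirac ()) α d 0 mD mI T ν (fun _ => ν) (fun _ => ν) := by
  intro z s t _ _ _
  rw [integral_dirac, ← Real.exp_add, bracket]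
  congr 1
  ring

/-! ### Consequences for the network -/

section Network

variable {Ω : Type*} [MeasurableSpace Ω] {P : Measure Ω} {lam : ℝ} {mD : ℕ} {mI : ℝ}
  {x : ℕ → Ω → EuclideanSpace ℝ (Fin 2)} {g : Fin 2 → Ω → ℝ} {h : Fin 2 → ℕ → Ω → ℝ} {α d : ℝ}

theorem gammaMoment_self_mul (δ r a : ℝ) :
    gammaMoment δ r a a = a ^ δ * gammaMoment δ r 1 1 := by
  simp only [gammaMoment]
  have : ∀ c u : ℝ, c * (1 - u) + c * u = c := fun c u => by ring
  simp only [this, Real.one_rpow, intervalIntegral.integral_mul_const]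
  ring

theorem two_div_pos_lt_one (hα : 2 < α) : 0 < 2 / α ∧ 0 < 1 - 2 / α := by
  have hα0 : 0 < α := by linarith
  refine ⟨by positivity, ?_⟩
  rw [sub_pos, div_lt_one hα0]
  exact hα

/-- `E exp(-a (I₁ + I₂)) = exp(-π λ c a ^ (2 / α))` for this constant `c`. -/
noncomputable def sumConst (α d mI : ℝ) : ℝ :=
  d ^ 2 * Real.Gamma (1 - 2 / α) * gammaMoment (2 / α) mI 1 1

theorem sumConst_nonneg (hα : 2 < α) (hmI : 0 < mI) : 0 ≤ sumConst α d mI := by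
  have hδ := two_div_pos_lt_one hα
  have h1 := Real.Gamma_pos_of_pos hδ.2
  have h2 := gammaMoment_nonneg hδ.1 hmI zero_le_one zero_le_one
  unfold sumConst
  positivity

theorem IsNetwork.lintegral_expNeg_mul_add (hn : IsNetwork P lam mD mI x g h) (hα : 2 < α)
    (hd : 0 < d) (hmI : 0 < mI) (hlam : 0 ≤ lam) {a : ℝ} (ha : 0 ≤ a) :
    ∫⁻ ω, expNeg (ENNReal.ofReal a *
        (interference α d x (h 0) ω + interference α d x (h 1) ω)) ∂P =
      ENNReal.ofReal (Real.exp (-(Real.pi * lam * sumConst α d mI * a ^ (2 / α)))) := by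
  have hc := sumConst_nonneg (d := d) hα hmI
  simp_rw [mul_add]
  rw [hn.lintegral_expNeg_interference hα hd hmI hlam ha ha, gammaMoment_self_mul,
    ← expNeg_ofReal (by positivity), sumConst]
  congr 2
  ring

/-- For `a > 0` the variable `exp(-a (I₁ + I₂))` vanishes where the sum is infinite, so its
expectation is at most the probability of finiteness; it tends to 1 as `a ↓ 0`. -/
theorem IsNetwork.ae_interference_lt_top (hn : IsNetwork P lam mD mI x g h) (hα : 2 < α)
    (hd : 0 < d) (hmI : 0 < mI) (hlam : 0 ≤ lam) :
    ∀ᵐ ω ∂P, interference α d x (h 0) ω + interference α d x (h 1) ω < ∞ := by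
  have := hn.isProbabilityMeasure
  have hδ := two_div_pos_lt_one hα
  have hmeas : Measurable fun ω => interference α d x (h 0) ω + interference α d x (h 1) ω :=
    (hn.measurable_interference α d 0).add (hn.measurable_interference α d 1)
  set S : Set Ω := {ω | interference α d x (h 0) ω + interference α d x (h 1) ω < ∞}
  have hS : MeasurableSet S := measurableSet_lt hmeas measurable_const
  have hle : ∀ a ∈ Ioi (0 : ℝ),
      ENNReal.ofReal (Real.exp (-(Real.pi * lam * sumConst α d mI * a ^ (2 / α)))) ≤ P S := by
    intro a ha
    rw [← hn.lintegral_expNeg_mul_add hα hd hmI hlam (le_of_lt ha), ← lintegral_indicator_one hS]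
    refine lintegral_mono fun ω => ?_
    by_cases hω : ω ∈ S
    · simpa [hω] using expNeg_le_one _
    · have : interference α d x (h 0) ω + interference α d x (h 1) ω = ∞ := not_lt_top_iff.1 hω
      simp only [this]
      rw [ENNReal.mul_top (by simpa using ha)]
      simp
  have hlim : Tendsto (fun a : ℝ =>
      ENNReal.ofReal (Real.exp (-(Real.pi * lam * sumConst α d mI * a ^ (2 / α))))) (𝓝[>] 0)
      (𝓝 1) := by
    have hcont : Continuous fun a : ℝ =>
        ENNReal.ofReal (Real.exp (-(Real.pi * lam * sumConst α d mI * a ^ (2 / α)))) := by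
      have := Real.continuous_rpow_const hδ.1.le
      exact ENNReal.continuous_ofReal.comp (by fun_prop)
    have := hcont.tendsto 0
    rw [Real.zero_rpow hδ.1.ne', mul_zero, neg_zero, Real.exp_zero, ENNReal.ofReal_one] at this
    exact this.mono_left nhdsWithin_le_nhds
  have hPS : P S = 1 := le_antisymm prob_le_one
    (le_of_tendsto hlim (eventually_nhdsWithin_of_forall hle))
  exact (prob_compl_eq_zero_iff hS).2 hPS

/-- `P(I₂ = 0) ≤ E exp(-b I₂) = exp(-C b^(2/α))`, which tends to 0 as `b → ∞`. This keeps the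
denominator positive when there is no noise. -/
theorem IsNetwork.ae_interference_pos (hn : IsNetwork P lam mD mI x g h) (hα : 2 < α)
    (hd : 0 < d) (hmI : 0 < mI) (hlam : 0 < lam) :
    ∀ᵐ ω ∂P, 0 < interference α d x (h 1) ω := by
  have := hn.isProbabilityMeasure
  have hδ := two_div_pos_lt_one hα
  set S : Set Ω := {ω | interference α d x (h 1) ω = 0}
  have hS : MeasurableSet S := hn.measurable_interference α d 1 (measurableSet_singleton 0)
  obtain ⟨C, hC, hCeq⟩ : ∃ C : ℝ, 0 < C ∧ ∀ b : ℝ, 0 ≤ b → Real.pi * lam *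
      (d ^ 2 * Real.Gamma (1 - 2 / α) * gammaMoment (2 / α) mI 0 b) = C * b ^ (2 / α) := by
    have h1 := Real.Gamma_pos_of_pos hδ.2
    have h2 := Real.Gamma_pos_of_pos hmI
    have h3 := Real.Gamma_pos_of_pos (add_pos hδ.1 hmI)
    refine ⟨Real.pi * lam * (d ^ 2 * Real.Gamma (1 - 2 / α) *
      (mI ^ (-(2 / α)) * (Real.Gamma (2 / α + mI) / Real.Gamma mI))), by positivity,
      fun b hb => ?_⟩
    rw [gammaMoment_zero_left hδ.1 hmI hb]
    ring
  have hle : ∀ b ∈ Ici (0 : ℝ), P S ≤ ENNReal.ofReal (Real.exp (-(C * b ^ (2 / α)))) := by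
    intro b hb
    have hb : 0 ≤ b := hb
    have := hn.lintegral_expNeg_interference (d := d) hα hd hmI hlam.le le_rfl hb
    rw [hCeq b hb, expNeg_ofReal (by positivity)] at this
    rw [← this, ← lintegral_indicator_one hS]
    refine lintegral_mono fun ω => ?_
    by_cases hω : ω ∈ S
    · have hω' : interference α d x (h 1) ω = 0 := hω
      simp [hω, hω']
    · simp [hω]
  have hlim : Tendsto (fun b : ℝ => ENNReal.ofReal (Real.exp (-(C * b ^ (2 / α))))) atTop
      (𝓝 0) := by
    rw [← ENNReal.ofReal_zero]
    refine ENNReal.tendsto_ofReal (Real.tendsto_exp_neg_atTop_nhds_zero.comp ?_)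
    exact (tendsto_rpow_atTop hδ.1).const_mul_atTop hC
  have hPS : P S = 0 := le_antisymm
    (ge_of_tendsto hlim ((eventually_ge_atTop 0).mono hle)) zero_le
  filter_upwards [measure_eq_zero_iff_ae_notMem.1 hPS] with ω hω
  exact pos_iff_ne_zero.2 hω

/-- Interference-plus-noise power at antenna `n`. -/
noncomputable def noisyPower {Ω : Type*} (α d ν : ℝ) (x : ℕ → Ω → EuclideanSpace ℝ (Fin 2))
    (h : ℕ → Ω → ℝ) (ω : Ω) : ℝ :=
  (interference α d x h ω).toReal + ν

theorem IsNetwork.measurable_noisyPower (hn : IsNetwork P lam mD mI x g h) (α d ν : ℝ)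
    (n : Fin 2) : Measurable (noisyPower α d ν x (h n)) :=
  (hn.measurable_interference α d n).ennreal_toReal.add_const ν

theorem noisyPower_nonneg {Ω : Type*} {α d ν : ℝ} (hν : 0 ≤ ν)
    (x : ℕ → Ω → EuclideanSpace ℝ (Fin 2)) (h : ℕ → Ω → ℝ) (ω : Ω) :
    0 ≤ noisyPower α d ν x h ω :=
  add_nonneg ENNReal.toReal_nonneg hν

theorem IsNetwork.ae_noisyPower_pos (hn : IsNetwork P lam mD mI x g h) (hα : 2 < α)
    (hd : 0 < d) (hmI : 0 < mI) (hlam : 0 < lam) {ν : ℝ} (hν : 0 ≤ ν) :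
    ∀ᵐ ω ∂P, 0 < noisyPower α d ν x (h 1) ω := by
  filter_upwards [hn.ae_interference_lt_top hα hd hmI hlam.le,
    hn.ae_interference_pos hα hd hmI hlam] with ω h1 h2
  exact add_pos_of_pos_of_nonneg
    (ENNReal.toReal_pos h2.ne' (ENNReal.add_lt_top.1 h1).2.ne) hν

/-- The noise is deterministic and factors out; the rest is the joint Laplace transform of the
interference. Passing to `toReal` is harmless because the interference is almost surely finite. -/
theorem IsNetwork.bracketIsLaplace (hn : IsNetwork P lam mD mI x g h) (hα : 2 < α) (hd : 0 < d)
    (hmD : 0 < mD) (hmI : 0 < mI) (hlam : 0 ≤ lam) (T ν : ℝ) :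
    BracketIsLaplace P α d lam mD mI T ν (noisyPower α d ν x (h 0)) (noisyPower α d ν x (h 1)) := by
  intro z s t hz hs ht
  have hδ := two_div_pos_lt_one hα
  have hΓ := Real.Gamma_pos_of_pos hδ.2
  rw [bracket, calA_eq_gammaMoment (by linarith) hmI hmD hz hs ht]
  set a := s * (mD * max 0 (T - z)) with ha
  set b := t * (mD * z) with hb
  have ha0 : 0 ≤ a := by positivity
  have hb0 : 0 ≤ b := by positivity
  have hM := gammaMoment_nonneg hδ.1 hmI ha0 hb0
  set K := Real.pi * lam * (d ^ 2 * Real.Gamma (1 - 2 / α) * gammaMoment (2 / α) mI a b) with hK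
  have hK0 : 0 ≤ K := by positivity
  have hL : ∫ ω, Real.exp (-(a * (interference α d x (h 0) ω).toReal +
      b * (interference α d x (h 1) ω).toReal)) ∂P = Real.exp (-K) := by
    have h0m := (hn.measurable_interference α d 0).ennreal_toReal
    have h1m := (hn.measurable_interference α d 1).ennreal_toReal
    rw [integral_eq_lintegral_of_nonneg_ae (ae_of_all _ fun ω => (Real.exp_pos _).le)
      (Measurable.aestronglyMeasurable (by fun_prop))]
    have := hn.lintegral_expNeg_interference (d := d) hα hd hmI hlam ha0 hb0
    rw [← hK, expNeg_ofReal hK0] at this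
    rw [← ENNReal.toReal_ofReal (Real.exp_pos (-K)).le, ← this]
    congr 1
    refine lintegral_congr_ae ?_
    filter_upwards [hn.ae_interference_lt_top hα hd hmI hlam] with ω hω
    have h0 := (ENNReal.add_lt_top.1 hω).1.ne
    have h1 := (ENNReal.add_lt_top.1 hω).2.ne
    rw [← expNeg_ofReal (by positivity), ENNReal.ofReal_add (by positivity) (by positivity),
      ENNReal.ofReal_mul ha0, ENNReal.ofReal_mul hb0, ENNReal.ofReal_toReal h0,
      ENNReal.ofReal_toReal h1]
  have hint : ∀ ω, Real.exp (-(s * (mD * max 0 (T - z) * noisyPower α d ν x (h 0) ω))) *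
      Real.exp (-(t * (mD * z * noisyPower α d ν x (h 1) ω))) =
      Real.exp (-(a * ν + b * ν)) * Real.exp (-(a * (interference α d x (h 0) ω).toReal +
        b * (interference α d x (h 1) ω).toReal)) := by
    intro ω
    rw [← Real.exp_add, ← Real.exp_add, noisyPower, noisyPower]
    congr 1
    ring
  simp_rw [hint]
  rw [integral_const_mul, hL, ← Real.exp_add]
  congr 1
  ring

theorem IsNetwork.formulaMeaningful (hn : IsNetwork P lam mD mI x g h) (hα : 2 < α) (hd : 0 < d)
    (hmD : 0 < mD) (hmI : 0 < mI) (hlam : 0 ≤ lam) (T : ℝ) {ν : ℝ} (hν : 0 ≤ ν) :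
    FormulaMeaningful α d lam mD mI T ν := by
  have := hn.isProbabilityMeasure
  exact (hn.bracketIsLaplace hα hd hmD hmI hlam T ν).formulaMeaningful hmD
    (hn.measurable_noisyPower α d ν 0) (hn.measurable_noisyPower α d ν 1)
    (noisyPower_nonneg hν _ _) (noisyPower_nonneg hν _ _)

theorem IsNetwork.formula_eq (hn : IsNetwork P lam mD mI x g h) (hα : 2 < α) (hd : 0 < d)
    (hmD : 0 < mD) (hmI : 0 < mI) (hlam : 0 < lam) (T : ℝ) {ν : ℝ} (hν : 0 ≤ ν) :
    formula α d lam mD mI T ν = ∫ ω, condSuccess mD T (noisyPower α d ν x (h 0) ω)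
      (noisyPower α d ν x (h 1) ω) ∂P := by
  have := hn.isProbabilityMeasure
  exact (hn.bracketIsLaplace hα hd hmD hmI hlam.le T ν).formula_eq hmD
    (hn.measurable_noisyPower α d ν 0) (hn.measurable_noisyPower α d ν 1)
    (noisyPower_nonneg hν _ _) (noisyPower_nonneg hν _ _)
    (hn.ae_noisyPower_pos hα hd hmI hlam hν)

/-- The success probability for deterministic interference-plus-noise powers. -/
theorem lintegral_indicator_sinr {m : ℕ} (hm : 0 < m) {T w₁ w₂ : ℝ} (hw₁ : 0 < w₁)
    (hw₂ : 0 < w₂) :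
    ∫⁻ y', ∫⁻ y, {p : ℝ × ℝ | ENNReal.ofReal T ≤ ENNReal.ofReal p.1 / ENNReal.ofReal w₁ +
      ENNReal.ofReal p.2 / ENNReal.ofReal w₂}.indicator (fun _ => (1 : ℝ≥0∞)) (y, y')
      ∂(gammaMeasure m m) ∂(gammaMeasure m m) = ENNReal.ofReal (condSuccess m T w₁ w₂) := by
  rw [condSuccess, ofReal_integral_eq_lintegral_ofReal
    (integrable_condSuccess_integrand hm T hw₁.le w₂)
    (ae_of_all _ fun y => poissonTail_nonneg m (poissonTail_arg_nonneg m T hw₁.le _))]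
  refine lintegral_congr_ae ?_
  filter_upwards [ae_nonneg_gammaMeasure m m] with y' hy'
  rw [mul_assoc, ← gammaMeasure_Ici hm (by positivity), ← lintegral_indicator_one measurableSet_Ici]
  refine lintegral_congr_ae ?_
  filter_upwards [ae_nonneg_gammaMeasure m m] with y hy
  -- For a given second gain the event is a lower bound on the first; the positive part costs
  -- nothing since `y ≥ 0`.
  have hiff : (y, y') ∈ {p : ℝ × ℝ | ENNReal.ofReal T ≤ ENNReal.ofReal p.1 / ENNReal.ofReal w₁ +
      ENNReal.ofReal p.2 / ENNReal.ofReal w₂} ↔ y ∈ Ici (w₁ * max 0 (T - y' / w₂)) := by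
    rw [mem_ofPred_eq, mem_Ici, ← ENNReal.ofReal_div_of_pos hw₁, ← ENNReal.ofReal_div_of_pos hw₂,
      ← ENNReal.ofReal_add (by positivity) (by positivity),
      ENNReal.ofReal_le_ofReal_iff (by positivity), ← le_div_iff₀' hw₁, max_le_iff, sub_le_iff_le_add]
    exact ⟨fun h => ⟨by positivity, h⟩, fun h => h.2⟩
  by_cases hmem : y ∈ Ici (w₁ * max 0 (T - y' / w₂))
  · rw [indicator_of_mem (hiff.2 hmem), indicator_of_mem hmem]
    rfl
  · rw [indicator_of_notMem (fun h => hmem (hiff.1 h)), indicator_of_notMem hmem]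

/-- The gains are integrated out for fixed interference. Positive noise makes both denominators
positive, and they are almost surely finite, so the extended-real event becomes the real one. -/
theorem IsNetwork.successProb_eq (hn : IsNetwork P lam mD mI x g h) (hα : 2 < α) (hd : 0 < d)
    (hmD : 0 < mD) (hmI : 0 < mI) (hlam : 0 ≤ lam) (T : ℝ) {SNR : ℝ} (hS : 0 < SNR) :
    successProb P α d SNR T x g h = ∫ ω, condSuccess mD T (noisyPower α d SNR⁻¹ x (h 0) ω)
      (noisyPower α d SNR⁻¹ x (h 1) ω) ∂P := by
  have := hn.isProbabilityMeasure
  have hν : 0 < SNR⁻¹ := inv_pos.2 hS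
  set A : Set ((ℝ≥0∞ × ℝ≥0∞) × ℝ × ℝ) := {p | ENNReal.ofReal T ≤
    ENNReal.ofReal p.2.1 / (p.1.1 + ENNReal.ofReal SNR⁻¹) +
      ENNReal.ofReal p.2.2 / (p.1.2 + ENNReal.ofReal SNR⁻¹)} with hA
  have hAm : MeasurableSet A := measurableSet_le (by fun_prop) (by fun_prop)
  have hψ : Measurable fun p : (ℝ≥0∞ × ℝ≥0∞) × ℝ × ℝ =>
      A.indicator (fun _ => (1 : ℝ≥0∞)) (p.1, p.2.1, p.2.2) := measurable_const.indicator hAm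
  have key := hn.lintegral_interference_gains hmD α d
    (ψ := fun I y y' => A.indicator (fun _ => (1 : ℝ≥0∞)) (I, y, y')) hψ
  have hJm : Measurable fun ω => ((interference α d x (h 0) ω, interference α d x (h 1) ω),
      g 0 ω, g 1 ω) :=
    ((hn.measurable_interference α d 0).prodMk (hn.measurable_interference α d 1)).prodMk
      ((hn.measurable_g 0).prodMk (hn.measurable_g 1))
  have hset : {ω | ENNReal.ofReal T ≤ sinr α d SNR x g h ω} =
      (fun ω => ((interference α d x (h 0) ω, interference α d x (h 1) ω), g 0 ω, g 1 ω)) ⁻¹' A := by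
    ext ω
    simp [sinr, hA, Fin.sum_univ_two]
  rw [successProb, hset, measureReal_def, ← lintegral_indicator_one (hJm hAm)]
  rw [integral_eq_lintegral_of_nonneg_ae (ae_of_all _ fun ω => condSuccess_nonneg mD T
    (noisyPower_nonneg hν.le _ _ ω) _) ((measurable_condSuccess mD T).comp
      ((hn.measurable_noisyPower α d SNR⁻¹ 0).prodMk
        (hn.measurable_noisyPower α d SNR⁻¹ 1))).aestronglyMeasurable]
  congr 1
  refine Eq.trans ?_ (key.trans (lintegral_congr_ae ?_))
  · rfl
  · filter_upwards [hn.ae_interference_lt_top hα hd hmI hlam] with ω hω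
    have h0 := (ENNReal.add_lt_top.1 hω).1.ne
    have h1 := (ENNReal.add_lt_top.1 hω).2.ne
    have hw : ∀ n, interference α d x (h n) ω ≠ ∞ →
        interference α d x (h n) ω + ENNReal.ofReal SNR⁻¹ =
        ENNReal.ofReal (noisyPower α d SNR⁻¹ x (h n) ω) := fun n hne => by
      rw [noisyPower, ENNReal.ofReal_add ENNReal.toReal_nonneg hν.le, ENNReal.ofReal_toReal hne]
    have hpos : ∀ n, 0 < noisyPower α d SNR⁻¹ x (h n) ω := fun n =>
      add_pos_of_nonneg_of_pos ENNReal.toReal_nonneg hν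
    rw [← lintegral_indicator_sinr hmD (hpos 0) (hpos 1), ← hw 0 h0, ← hw 1 h1]
    rfl

/-! ### Limits of vanishing noise and of vanishing density. -/

theorem IsNetwork.tendsto_integral_condSuccess (hn : IsNetwork P lam mD mI x g h) (hα : 2 < α)
    (hd : 0 < d) (hmD : 0 < mD) (hmI : 0 < mI) (hlam : 0 < lam) (T : ℝ) :
    Tendsto (fun SNR : ℝ => ∫ ω, condSuccess mD T (noisyPower α d SNR⁻¹ x (h 0) ω)
      (noisyPower α d SNR⁻¹ x (h 1) ω) ∂P) atTop
      (𝓝 (∫ ω, condSuccess mD T (noisyPower α d 0 x (h 0) ω) (noisyPower α d 0 x (h 1) ω) ∂P)) := by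
  have := hn.isProbabilityMeasure
  have hnn : ∀ᶠ SNR : ℝ in atTop, 0 ≤ SNR⁻¹ :=
    (eventually_ge_atTop 0).mono fun S hS => inv_nonneg.2 hS
  refine tendsto_integral_filter_of_dominated_convergence (fun _ => 1)
    (Eventually.of_forall fun S => ?_) (hnn.mono fun S hS => ae_of_all _ fun ω => ?_)
    (integrable_const _) ?_
  · exact ((measurable_condSuccess mD T).comp ((hn.measurable_noisyPower α d S⁻¹ 0).prodMk
      (hn.measurable_noisyPower α d S⁻¹ 1))).aestronglyMeasurable
  · have h0 := noisyPower_nonneg (α := α) (d := d) hS x (h 0) ω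
    rw [Real.norm_of_nonneg (condSuccess_nonneg mD T h0 _)]
    exact condSuccess_le_one hmD T h0 _
  -- Convergence at the noise-free limit needs a positive second denominator there, which the
  -- interference alone provides.
  · filter_upwards [hn.ae_noisyPower_pos hα hd hmI hlam le_rfl] with ω hω
    have hlim : ∀ n, Tendsto (fun S : ℝ => noisyPower α d S⁻¹ x (h n) ω) atTop
        (𝓝 (noisyPower α d 0 x (h n) ω)) := fun n =>
      tendsto_const_nhds.add tendsto_inv_atTop_zero
    exact tendsto_condSuccess hmD T (hlim 0) (hlim 1)
      (hnn.mono fun S hS => noisyPower_nonneg hS _ _ ω) hω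

/-- Where `J ≥ η` the deviation is at most 1, hence at most `(1 - e^(-J)) / (1 - e^(-η))`: Markov's
inequality for `1 - e^(-J)`, which requires only the Laplace transform of `J`. -/
theorem abs_integral_sub_le [IsProbabilityMeasure P] {f J : Ω → ℝ} (hfm : Measurable f)
    (hf0 : ∀ ω, 0 ≤ f ω) (hf1 : ∀ ω, f ω ≤ 1) (hJm : Measurable J) (hJ0 : ∀ ω, 0 ≤ J ω)
    {ε η c : ℝ} (hε : 0 ≤ ε) (hη : 0 < η) (hc : 0 ≤ c) (hc1 : c ≤ 1)
    (hcont : ∀ ω, J ω < η → |f ω - c| ≤ ε) :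
    |∫ ω, f ω ∂P - c| ≤ ε + (1 - ∫ ω, Real.exp (-J ω) ∂P) / (1 - Real.exp (-η)) := by
  have hden : 0 < 1 - Real.exp (-η) := sub_pos.2 (Real.exp_lt_one_iff.2 (neg_lt_zero.2 hη))
  have hexp1 : ∀ ω, Real.exp (-J ω) ≤ 1 := fun ω => Real.exp_le_one_iff.2 (neg_nonpos.2 (hJ0 ω))
  have hJint : Integrable (fun ω => Real.exp (-J ω)) P :=
    Integrable.of_bound (C := 1) (by fun_prop) (ae_of_all _ fun ω => by
      rw [Real.norm_of_nonneg (Real.exp_pos _).le]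
      exact hexp1 ω)
  have hfint : Integrable f P := Integrable.of_bound (C := 1) hfm.aestronglyMeasurable
    (ae_of_all _ fun ω => by
      rw [Real.norm_of_nonneg (hf0 ω)]
      exact hf1 ω)
  have hbound : ∀ ω, |f ω - c| ≤ ε + (1 - Real.exp (-J ω)) / (1 - Real.exp (-η)) := by
    intro ω
    rcases lt_or_ge (J ω) η with hlt | hge
    · refine (hcont ω hlt).trans ?_
      exact le_add_of_nonneg_right (div_nonneg (sub_nonneg.2 (hexp1 ω)) hden.le)
    · have h1 : 1 ≤ (1 - Real.exp (-J ω)) / (1 - Real.exp (-η)) := by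
        rw [one_le_div hden]
        have := Real.exp_le_exp.2 (neg_le_neg hge)
        linarith
      have h2 : |f ω - c| ≤ 1 := by
        rw [abs_le]
        constructor <;> linarith [hf0 ω, hf1 ω]
      linarith
  have hsub : ∫ ω, f ω ∂P - c = ∫ ω, (f ω - c) ∂P := by
    rw [integral_sub hfint (integrable_const c)]
    simp
  have hdiff : Integrable (fun ω => (1 - Real.exp (-J ω)) / (1 - Real.exp (-η))) P :=
    ((integrable_const (1 : ℝ)).sub hJint).div_const _
  have hval : ∫ ω, (ε + (1 - Real.exp (-J ω)) / (1 - Real.exp (-η))) ∂P =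
      ε + (1 - ∫ ω, Real.exp (-J ω) ∂P) / (1 - Real.exp (-η)) := by
    rw [integral_add (integrable_const ε) hdiff, integral_div,
      integral_sub (integrable_const (1 : ℝ)) hJint]
    simp
  rw [hsub, ← hval]
  exact abs_integral_le_integral_abs.trans (integral_mono (hfint.sub (integrable_const c)).abs
    ((integrable_const ε).add hdiff) hbound)

theorem IsNetwork.abs_integral_condSuccess_sub_le (hn : IsNetwork P lam mD mI x g h) (hα : 2 < α)
    (hd : 0 < d) (hmD : 0 < mD) (hmI : 0 < mI) (hlam : 0 ≤ lam) {T ν ε η c : ℝ} (hν : 0 ≤ ν)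
    (hε : 0 ≤ ε) (hη : 0 < η) (hc : 0 ≤ c) (hc1 : c ≤ 1)
    (hcont : ∀ u v : ℝ, 0 ≤ u → 0 ≤ v → u + v < η → |condSuccess mD T (u + ν) (v + ν) - c| ≤ ε) :
    |∫ ω, condSuccess mD T (noisyPower α d ν x (h 0) ω) (noisyPower α d ν x (h 1) ω) ∂P - c| ≤
      ε + (1 - Real.exp (-(Real.pi * lam * sumConst α d mI))) / (1 - Real.exp (-η)) := by
  have := hn.isProbabilityMeasure
  have hI := fun n => (hn.measurable_interference α d n).ennreal_toReal
  have hJm : Measurable fun ω => (interference α d x (h 0) ω).toReal +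
      (interference α d x (h 1) ω).toReal := (hI 0).add (hI 1)
  have hJ0 : ∀ ω, 0 ≤ (interference α d x (h 0) ω).toReal + (interference α d x (h 1) ω).toReal :=
    fun ω => add_nonneg ENNReal.toReal_nonneg ENNReal.toReal_nonneg
  have hL : ∫ ω, Real.exp (-((interference α d x (h 0) ω).toReal +
      (interference α d x (h 1) ω).toReal)) ∂P =
      Real.exp (-(Real.pi * lam * sumConst α d mI)) := by
    have h1 := hn.lintegral_expNeg_mul_add hα hd hmI hlam (a := 1) zero_le_one
    rw [Real.one_rpow, mul_one] at h1
    rw [integral_eq_lintegral_of_nonneg_ae (ae_of_all _ fun ω => (Real.exp_pos _).le)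
      (Measurable.aestronglyMeasurable (by fun_prop)),
      ← ENNReal.toReal_ofReal (Real.exp_pos (-(Real.pi * lam * sumConst α d mI))).le, ← h1]
    congr 1
    refine lintegral_congr_ae ?_
    filter_upwards [hn.ae_interference_lt_top hα hd hmI hlam] with ω hω
    rw [← expNeg_ofReal (hJ0 ω), ENNReal.ofReal_one, one_mul,
      ← ENNReal.toReal_add (ENNReal.add_lt_top.1 hω).1.ne (ENNReal.add_lt_top.1 hω).2.ne,
      ENNReal.ofReal_toReal hω.ne]
  rw [← hL]
  exact abs_integral_sub_le ((measurable_condSuccess mD T).comp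
    ((hn.measurable_noisyPower α d ν 0).prodMk (hn.measurable_noisyPower α d ν 1)))
    (fun ω => condSuccess_nonneg mD T (noisyPower_nonneg hν _ _ ω) _)
    (fun ω => condSuccess_le_one hmD T (noisyPower_nonneg hν _ _ ω) _)
    hJm hJ0 hε hη hc hc1
    (fun ω hω => hcont _ _ ENNReal.toReal_nonneg ENNReal.toReal_nonneg hω)

end Network

theorem exists_abs_condSuccess_sub_le {m : ℕ} (hm : 0 < m) (T : ℝ) {ν ε : ℝ} (hν : 0 < ν)
    (hε : 0 < ε) : ∃ η > 0, ∀ u v : ℝ, 0 ≤ u → 0 ≤ v → u + v < η →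
      |condSuccess m T (u + ν) (v + ν) - condSuccess m T ν ν| ≤ ε := by
  have h1 : Tendsto (fun p : ℝ × ℝ => p.1 + ν) (𝓝 (0, 0)) (𝓝 ν) := by
    have : Continuous fun p : ℝ × ℝ => p.1 + ν := by fun_prop
    simpa using this.tendsto (0, 0)
  have h2 : Tendsto (fun p : ℝ × ℝ => p.2 + ν) (𝓝 (0, 0)) (𝓝 ν) := by
    have : Continuous fun p : ℝ × ℝ => p.2 + ν := by fun_prop
    simpa using this.tendsto (0, 0)
  have h3 := tendsto_condSuccess hm T h1 h2 ((Filter.Tendsto.eventually_const_lt hν h1).mono fun _ h => h.le) hν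
  obtain ⟨η, hη, hball⟩ := Metric.eventually_nhds_iff.1 (Metric.tendsto_nhds.1 h3 ε hε)
  refine ⟨η, hη, fun u v hu hv huv => ?_⟩
  have hdist : dist (u, v) ((0 : ℝ), (0 : ℝ)) < η := by
    rw [Prod.dist_eq, Real.dist_eq, Real.dist_eq, sub_zero, sub_zero, abs_of_nonneg hu,
      abs_of_nonneg hv]
    exact max_lt (by linarith) (by linarith)
  exact (hball hdist).le

/-- No coupling of the networks is available, so the estimate is made separately for each density:
`η` is fixed by continuity at `(ν, ν)`, and the Laplace term then vanishes with the density. -/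
theorem tendsto_integral_condSuccess_of_density {Ω : ℝ → Type*} [∀ lam, MeasurableSpace (Ω lam)]
    {P : ∀ lam, Measure (Ω lam)} {x : ∀ lam, ℕ → Ω lam → EuclideanSpace ℝ (Fin 2)}
    {g : ∀ lam, Fin 2 → Ω lam → ℝ} {h : ∀ lam, Fin 2 → ℕ → Ω lam → ℝ} {α d mI : ℝ} {mD : ℕ}
    (hnet : ∀ lam, 0 < lam → IsNetwork (P lam) lam mD mI (x lam) (g lam) (h lam)) (hα : 2 < α)
    (hd : 0 < d) (hmD : 0 < mD) (hmI : 0 < mI) (T : ℝ) {ν : ℝ} (hν : 0 < ν) :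
    Tendsto (fun lam => ∫ ω, condSuccess mD T (noisyPower α d ν (x lam) (h lam 0) ω)
      (noisyPower α d ν (x lam) (h lam 1) ω) ∂(P lam)) (𝓝[>] 0) (𝓝 (condSuccess mD T ν ν)) := by
  rw [Metric.tendsto_nhds]
  intro ε hε
  obtain ⟨η, hη, hcont⟩ := exists_abs_condSuccess_sub_le hmD T hν (half_pos hε)
  have hlim : Tendsto (fun lam : ℝ => ε / 2 +
      (1 - Real.exp (-(Real.pi * lam * sumConst α d mI))) / (1 - Real.exp (-η))) (𝓝[>] 0)
      (𝓝 (ε / 2)) := by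
    have hc : Continuous fun lam : ℝ => ε / 2 +
      (1 - Real.exp (-(Real.pi * lam * sumConst α d mI))) / (1 - Real.exp (-η)) := by fun_prop
    have := hc.tendsto 0
    simp only [mul_zero, zero_mul, neg_zero, Real.exp_zero, sub_self, zero_div, add_zero] at this
    exact this.mono_left nhdsWithin_le_nhds
  filter_upwards [hlim.eventually_lt_const (half_lt_self hε), self_mem_nhdsWithin] with lam h1 h2
  have h2 : 0 < lam := h2
  exact ((hnet lam h2).abs_integral_condSuccess_sub_le hα hd hmD hmI h2.le hν.le (half_pos hε).le hη
    (condSuccess_nonneg mD T hν.le ν) (condSuccess_le_one hmD T hν.le ν) hcont).trans_lt h1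

theorem formula_zero_eq {α d mI T ν : ℝ} {mD : ℕ} (hmD : 0 < mD) (hT : 0 < T) (hν : 0 < ν) :
    formula α d 0 mD mI T ν = regUpperGamma (2 * mD) (mD * T * ν) := by
  rw [(bracketIsLaplace_zero α d mD mI T ν).formula_eq hmD measurable_const measurable_const
    (fun _ => hν.le) (fun _ => hν.le) (ae_of_all _ fun _ => hν), integral_const,
    condSuccess_self_eq_regUpperGamma hmD hT hν]
  simp

end MRC

/-! ### The two regimes. -/

theorem mainTheorem6
    (α d mI T : ℝ) (mD : ℕ) (hα : 2 < α) (hd : 0 < d) (hmI : 0 < mI) (hmD : 0 < mD) (hT : 0 < T)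
    -- for each density `lam > 0`, a dual-antenna network with interferer density `lam`
    {Ω : ℝ → Type*} [∀ lam, MeasurableSpace (Ω lam)] (P : ∀ lam, Measure (Ω lam))
    (x : ∀ lam, ℕ → Ω lam → EuclideanSpace ℝ (Fin 2))
    (g : ∀ lam, Fin 2 → Ω lam → ℝ) (h : ∀ lam, Fin 2 → ℕ → Ω lam → ℝ)
    (hnet : ∀ lam, 0 < lam → MRC.IsNetwork (P lam) lam mD mI (x lam) (g lam) (h lam)) :
    -- interference-limited regime
    (∀ lam : ℝ, 0 < lam →
      (∀ SNR : ℝ, 0 < SNR → MRC.FormulaMeaningful α d lam mD mI T SNR⁻¹) ∧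
      MRC.FormulaMeaningful α d lam mD mI T 0 ∧
      Tendsto (fun SNR => MRC.successProb (P lam) α d SNR T (x lam) (g lam) (h lam)) atTop
        (𝓝 (MRC.formula α d lam mD mI T 0)) ∧
      Tendsto (fun SNR => MRC.formula α d lam mD mI T SNR⁻¹) atTop
        (𝓝 (MRC.formula α d lam mD mI T 0))) ∧
    -- noise-limited regime
    (∀ SNR : ℝ, 0 < SNR →
      MRC.FormulaMeaningful α d 0 mD mI T SNR⁻¹ ∧
      Tendsto (fun lam => MRC.successProb (P lam) α d SNR T (x lam) (g lam) (h lam)) (𝓝[>] 0)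
        (𝓝 (MRC.regUpperGamma (2 * mD) (mD * T / SNR))) ∧
      Tendsto (fun lam => MRC.formula α d lam mD mI T SNR⁻¹) (𝓝[>] 0)
        (𝓝 (MRC.regUpperGamma (2 * mD) (mD * T / SNR))) ∧
      MRC.formula α d 0 mD mI T SNR⁻¹ = MRC.regUpperGamma (2 * mD) (mD * T / SNR)) := by
  refine ⟨fun lam hlam => ?_, fun SNR hS => ?_⟩
  · have hn := hnet lam hlam
    have hlim := hn.tendsto_integral_condSuccess hα hd hmD hmI hlam T
    rw [← hn.formula_eq hα hd hmD hmI hlam T le_rfl] at hlim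
    refine ⟨fun SNR hS => hn.formulaMeaningful hα hd hmD hmI hlam.le T (inv_pos.2 hS).le,
      hn.formulaMeaningful hα hd hmD hmI hlam.le T le_rfl, hlim.congr' ?_, hlim.congr' ?_⟩
    · filter_upwards [eventually_gt_atTop 0] with SNR hS
      exact (hn.successProb_eq hα hd hmD hmI hlam.le T hS).symm
    · filter_upwards [eventually_gt_atTop 0] with SNR hS
      exact (hn.formula_eq hα hd hmD hmI hlam T (inv_pos.2 hS).le).symm
  · have hν : 0 < SNR⁻¹ := inv_pos.2 hS
    have hlim := MRC.tendsto_integral_condSuccess_of_density hnet hα hd hmD hmI T hν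
    rw [MRC.condSuccess_self_eq_regUpperGamma hmD hT hν, ← div_eq_mul_inv] at hlim
    refine ⟨?_, hlim.congr' ?_, hlim.congr' ?_, ?_⟩
    · exact (MRC.bracketIsLaplace_zero α d mD mI T SNR⁻¹).formulaMeaningful hmD measurable_const
        measurable_const (fun _ => hν.le) (fun _ => hν.le)
    · filter_upwards [self_mem_nhdsWithin] with lam hlam
      exact ((hnet lam hlam).successProb_eq hα hd hmD hmI (le_of_lt hlam) T hS).symm
    · filter_upwards [self_mem_nhdsWithin] with lam hlam
      exact ((hnet lam hlam).formula_eq hα hd hmD hmI hlam T hν.le).symm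
    · rw [MRC.formula_zero_eq hmD hT hν, ← div_eq_mul_inv]
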